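/- **Setting.** Let $V$ be a finite-dimensional complex vector space with an antilinear involution $j$, and let $R\subset V\otimes V$ be a subspace with $(j\otimes j)(R)=t(R)$, $t$ being the flip. Then $\mathcal A=A(V,R)=T(V)/(R)$ is a quadratic $*$-algebra with $Y^*=j(Y)=:\bar Y$ for $Y\in V$. For $Z\in V^*$ let $\bar Z\in V^*$ be given by $\bar Z(L)=\overline{Z(\bar L)}$, and use the same notation on $P(V^*)$. Elements of $V\otimes V$ are viewed as bilinear forms on $V^*$, elements of $V$ as linear functions $Z\mapsto Y(Z)$ on $V^*$. Let $\Gamma=\{(Z,Z')\in P(V^*)^2:\ \omega(Z,Z')=0\ \ \forall\omega\in R\}$, and assume that $\Gamma$ is the graph of a bijection $\sigma:E\to E$ of a subset $E\subset P(V^*)$ (the characteristic variety). A symmetric $Q\in S^2(V)$ is called *central* on $C\subset E\times E$ if for all $(Z,Z')\in C$ and $\omega\in R$ $$\omega(Z,Z')\,Q(\sigma(Z'),\sigma^{-1}(Z))+Q(Z,Z')\,\omega(\sigma(Z'),\sigma^{-1}(Z))=0 .$$ Given a compact $K\subset E$ with $\sigma(K)=K$ and a hermitian line bundle $\mathcal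 L$ on $K$, put $\mathcal L_n=\mathcal L\otimes\mathcal L^{\sigma}\otimes\cdots\otimes\mathcal L^{\sigma^{n-1}}$, where $\mathcal L^{\sigma^k}$ is the pull-back of $\mathcal L$ by $\sigma^k$. The $C^*$-algebra $C(K)\times_{\sigma,\mathcal L}\mathbb Z$ is the completion, in the norm $\sup_\pi\|\pi(a)\|$ over all involutive Hilbert space representations $\pi$, of the $*$-algebra spanned by the monomials $\xi W^n$, $W^{*n}\eta^*=(\eta W^n)^*$ with $\xi,\eta\in C(K,\mathcal L_n)$, $n\ge 0$, with the product determined by $(\xi_1W^{m})(\xi_2W^{n})=(\xi_1\otimes(\xi_2\circ\sigma^{m}))W^{m+n}$, $(W^{*n}\eta^*)(\xi W^n)=(\eta^*\xi)\circ\sigma^{-n}$ and $(\xi W^n)(W^{*n}\eta^*)=\xi\eta^*$. **Theorem 6.2.** Let $K\subset E$ be compact with $\sigma(K)=K$, and let $Q\in S^2(V)$ be central and strictly positive on $\{(Z,\bar Z):Z\in K\}$. Let $\mathcal L$ be the restriction to $K$ of the dual of the tautological line bundle of $P(V^*)$, with the hermitian metric $$\langle L,L'\rangle(Z)=\frac{L(Z)\,\overline{L'(Z)}}{Q(Z,\bar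 Z)},\qquad L,L'\in V,\ Z\in K,$$ and let $\|Y\|(Z)=|Y(Z)|/Q(Z,\bar Z)^{1/2}$ be the norm at $Z$ of the section given by $Y\in V$. (i) The equality $\sqrt2\,\theta(Y)=YW+W^*\bar Y^*$, $Y\in V$, defines a $*$-homomorphism $\theta:\mathcal A\to C(K)\times_{\sigma,\mathcal L}\mathbb Z$. (ii) For every $Y\in V$ the suprema below are finite and $$\sup_K\|Y\|\ \le\ \sqrt2\,\|\theta(Y)\|\ \le\ \sup_K\|Y\|+\sup_K\|\bar Y\| .$$ In particular $\sup_K\|Y\|\le\sqrt2\,\|\theta(Y)\|\le 2\sup_K\|Y\|$ if $\bar Y=Y$, and also, for all $Y\in V$, if $K$ is stable under $Z\mapsto\bar Z$. (iii) Let $K$ be contained in an irreducible component $E_0$ of $E$ (in the Zariski topology) that is stable under $\sigma$ and $Z\mapsto\bar Z$. If $Q$ is central on $E_0\times E_0$ and $\sigma^4\ne 1$ on $E_0$, then $\theta(Q)=1$, where $Q$ is viewed as an element of $T(V)/(R)$. -/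

import Mathlib

open scoped TensorProduct LinearAlgebra.Projectivization ENNReal BoundedContinuousFunction

universe u

noncomputable section

namespace QuadCross

/-! ## Quadratic star-algebras -/

/-- The datum of a quadratic `*`-algebra `A(V,R) = T(V)/(R)`: a space of relations
`R ⊆ V ⊗ V` and an antilinear involution `j` of `V` (the restriction of the involution of the
algebra to the generators) with `(j ⊗ j)(R) = t(R)`, where `t` is the flip of `V ⊗ V`. -/
structure StarQuadratic (V : Type u) [AddCommGroup V] [Module ℂ V] where
  R : Submodule ℂ (V ⊗[ℂ] V)
  j : V →ₛₗ[starRingEnd ℂ] V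
  j_j : ∀ v, j (j v) = v
  map_j_eq_map_flip :
    R.map (TensorProduct.map j j) = R.map (TensorProduct.comm ℂ V V).toLinearMap

/-- The opposite of a complex algebra `T`, with the conjugate complex structure: antilinear
anti-homomorphisms into `T` are the same as algebra homomorphisms into `ConjOp T`. -/
def ConjOp (T : Type u) : Type u := Tᵐᵒᵖ

instance (T : Type u) [Ring T] : Ring (ConjOp T) := inferInstanceAs (Ring Tᵐᵒᵖ)

instance (T : Type u) [Ring T] [Algebra ℂ T] : Algebra ℂ (ConjOp T) :=
  RingHom.toAlgebra' ((algebraMap ℂ Tᵐᵒᵖ).comp (starRingEnd ℂ))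
    (fun c x => Algebra.commutes (A := Tᵐᵒᵖ) (starRingEnd ℂ c) x)

variable {V : Type u} [AddCommGroup V] [Module ℂ V]

/-- The quadratic element of the tensor algebra given by a tensor in `V ⊗ V`. -/
def tensorTwo (V : Type u) [AddCommGroup V] [Module ℂ V] : V ⊗[ℂ] V →ₗ[ℂ] TensorAlgebra ℂ V :=
  TensorProduct.lift
    ((LinearMap.mul ℂ (TensorAlgebra ℂ V)).compl₁₂ (TensorAlgebra.ι ℂ) (TensorAlgebra.ι ℂ))

@[simp] lemma tensorTwo_tmul (v w : V) :
    tensorTwo V (v ⊗ₜ w) = TensorAlgebra.ι ℂ v * TensorAlgebra.ι ℂ w := by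
  simp [tensorTwo]

namespace StarQuadratic

variable (D : StarQuadratic V)

/-- The antilinear anti-automorphism of `T(V)` extending `j`, as an algebra homomorphism. -/
def starAux : TensorAlgebra ℂ V →ₐ[ℂ] ConjOp (TensorAlgebra ℂ V) :=
  TensorAlgebra.lift ℂ
    { toFun := fun v => (MulOpposite.op (TensorAlgebra.ι ℂ (D.j v)) : (TensorAlgebra ℂ V)ᵐᵒᵖ)
      map_add' := fun v w => by
        rw [map_add, map_add]; rfl
      map_smul' := fun c v => by
        refine Eq.trans ?_ (Algebra.smul_def (A := ConjOp (TensorAlgebra ℂ V)) c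
          (MulOpposite.op (TensorAlgebra.ι ℂ (D.j v)))).symm
        rw [LinearMap.map_smulₛₗ, map_smul, Algebra.smul_def, Algebra.commutes]
        rfl }

/-- The involution of `T(V)` extending `j`. -/
def tstar (x : TensorAlgebra ℂ V) : TensorAlgebra ℂ V :=
  MulOpposite.unop (D.starAux x : (TensorAlgebra ℂ V)ᵐᵒᵖ)

lemma tstar_ι (v : V) : D.tstar (TensorAlgebra.ι ℂ v) = TensorAlgebra.ι ℂ (D.j v) := by
  unfold tstar starAux
  rw [TensorAlgebra.lift_ι_apply]
  rfl

lemma tstar_mul (x y : TensorAlgebra ℂ V) : D.tstar (x * y) = D.tstar y * D.tstar x := by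
  unfold tstar
  rw [map_mul]
  rfl

lemma tstar_add (x y : TensorAlgebra ℂ V) : D.tstar (x + y) = D.tstar x + D.tstar y := by
  unfold tstar
  rw [map_add]
  rfl

lemma tstar_algebraMap (c : ℂ) :
    D.tstar (algebraMap ℂ _ c) = algebraMap ℂ _ (starRingEnd ℂ c) := by
  unfold tstar
  rw [AlgHom.commutes]
  rfl

lemma tstar_tstar (x : TensorAlgebra ℂ V) : D.tstar (D.tstar x) = x := by
  induction x using TensorAlgebra.induction with
  | algebraMap c => simp [tstar_algebraMap]
  | ι v => simp [tstar_ι, D.j_j]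
  | mul a b ha hb => rw [tstar_mul, tstar_mul, ha, hb]
  | add a b ha hb => rw [tstar_add, tstar_add, ha, hb]

/-- The tensor algebra with the involution extending `j`. -/
@[reducible]
def tensorStarRing : StarRing (TensorAlgebra ℂ V) where
  star := D.tstar
  star_involutive := D.tstar_tstar
  star_mul := D.tstar_mul
  star_add := D.tstar_add

lemma tstar_tensorTwo (ω : V ⊗[ℂ] V) :
    D.tstar (tensorTwo V ω) =
      tensorTwo V (TensorProduct.comm ℂ V V (TensorProduct.map D.j D.j ω)) := by
  induction ω using TensorProduct.induction_on with
  | zero => simpa using D.tstar_algebraMap 0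
  | tmul v w => simp [tstar_mul, tstar_ι]
  | add a b ha hb => simp [tstar_add, ha, hb]

/-- The relation `ω = 0` for `ω ∈ R`. -/
def Rel (a b : TensorAlgebra ℂ V) : Prop := ∃ ω ∈ D.R, a = tensorTwo V ω ∧ b = 0

lemma rel_star (a b : TensorAlgebra ℂ V) (h : D.Rel a b) :
    D.Rel (D.tstar a) (D.tstar b) := by
  obtain ⟨ω, hω, rfl, rfl⟩ := h
  refine ⟨_, ?_, D.tstar_tensorTwo ω, by simpa using D.tstar_algebraMap 0⟩
  have h1 : TensorProduct.map D.j D.j ω ∈ D.R.map (TensorProduct.map D.j D.j) :=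
    Submodule.mem_map_of_mem hω
  rw [D.map_j_eq_map_flip] at h1
  obtain ⟨ω', hω', h2⟩ := h1
  rw [← h2]
  have h3 : ∀ x : V ⊗[ℂ] V, TensorProduct.comm ℂ V V ((TensorProduct.comm ℂ V V).toLinearMap x) = x := by
    intro x
    induction x using TensorProduct.induction_on with
    | zero => simp
    | tmul v w => simp
    | add a b ha hb => simp only [map_add, ha, hb]
  rwa [h3]

/-- The quadratic algebra `A(V,R) = T(V)/(R)`, the quotient of the tensor algebra by the two-sided
ideal generated by `R`. -/
def Alg : Type u := RingQuot D.Rel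

instance : Ring D.Alg := inferInstanceAs (Ring (RingQuot D.Rel))
instance : Algebra ℂ D.Alg := inferInstanceAs (Algebra ℂ (RingQuot D.Rel))

/-- The involution of `A(V,R)`, induced by `j` on the generators. -/
instance : StarRing D.Alg :=
  letI := D.tensorStarRing
  RingQuot.starRing D.Rel D.rel_star

/-- The quotient map `T(V) → A(V,R)`. -/
def quot : TensorAlgebra ℂ V →ₐ[ℂ] D.Alg := RingQuot.mkAlgHom ℂ D.Rel

/-- The generator of `A(V,R)` given by `Y ∈ V`. -/
def gen (Y : V) : D.Alg := D.quot (TensorAlgebra.ι ℂ Y)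

/-- The quadratic element of `A(V,R)` given by `Q ∈ V ⊗ V`. -/
def quad (Q : V ⊗[ℂ] V) : D.Alg := D.quot (tensorTwo V Q)

lemma star_quot (x : TensorAlgebra ℂ V) : star (D.quot x) = D.quot (D.tstar x) := by
  have h : ∀ y, D.quot y = (RingQuot.mkRingHom D.Rel y : RingQuot D.Rel) := fun y => by
    rw [← RingQuot.mkAlgHom_coe ℂ]; rfl
  rw [h, h, RingQuot.mkRingHom_def]
  rfl

lemma star_gen (Y : V) : star (D.gen Y) = D.gen (D.j Y) := by
  rw [gen, star_quot, tstar_ι, gen]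

instance : StarModule ℂ D.Alg where
  star_smul c a := by
    obtain ⟨x, rfl⟩ := RingQuot.mkAlgHom_surjective ℂ D.Rel a
    change star (c • D.quot x) = starRingEnd ℂ c • star (D.quot x)
    rw [← map_smul, star_quot, star_quot, ← map_smul, Algebra.smul_def, tstar_mul, tstar_algebraMap,
      ← Algebra.commutes, Algebra.smul_def]

end StarQuadratic

/-! ## Geometric data: characteristic variety, correspondence, conjugation -/

/-- The projective space `P(V*)` of lines of the dual of `V`. -/
abbrev PDual (V : Type u) [AddCommGroup V] [Module ℂ V] : Type u := ℙ ℂ (Module.Dual ℂ V)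

/-- The topology of pointwise convergence on `V*`; for finite-dimensional `V` this is the usual
topology. -/
@[reducible]
def dualTopology (V : Type u) [AddCommGroup V] [Module ℂ V] :
    TopologicalSpace (Module.Dual ℂ V) :=
  TopologicalSpace.induced (fun (φ : Module.Dual ℂ V) (v : V) => φ v) inferInstance

/-- The usual (quotient) topology of `P(V*)`. -/
@[reducible]
def projTopology (V : Type u) [AddCommGroup V] [Module ℂ V] : TopologicalSpace (PDual V) :=
  letI := dualTopology V
  TopologicalSpace.coinduced
    (fun φ : {φ : Module.Dual ℂ V // φ ≠ 0} => Projectivization.mk' ℂ φ) inferInstance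

/-- The Zariski topology of `P(V*)`, generated by the complements of the zero loci of homogeneous
polynomials. Polynomial functions on `V*` are written as polynomials in the linear
functions `φ ↦ φ v`, `v ∈ V`. -/
@[reducible]
def zariskiTopology (V : Type u) [AddCommGroup V] [Module ℂ V] : TopologicalSpace (PDual V) :=
  TopologicalSpace.generateFrom
    {U | ∃ (f : MvPolynomial V ℂ) (d : ℕ), f.IsHomogeneous d ∧
      U = {Z : PDual V | MvPolynomial.eval (fun v : V => Z.rep v) f ≠ 0}}

/-- An irreducible component of `E ⊆ P(V*)`: a maximal Zariski-irreducible subset of `E`. -/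
def IsComponent (E S : Set (PDual V)) : Prop :=
  Maximal (fun S : Set (PDual V) => S ⊆ E ∧ @IsIrreducible _ (zariskiTopology V) S) S

/-- The value `ω(α, β) = ⟨ω, α ⊗ β⟩` of `ω ∈ V ⊗ V`, viewed as a bilinear form on `V*`. -/
def ev (ω : V ⊗[ℂ] V) (α β : Module.Dual ℂ V) : ℂ :=
  TensorProduct.dualDistrib ℂ V V (α ⊗ₜ[ℂ] β) ω

lemma ev_tmul (v w : V) (α β : Module.Dual ℂ V) : ev (v ⊗ₜ[ℂ] w) α β = α v * β w := by
  simp [ev]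

lemma ev_add (ω ω' : V ⊗[ℂ] V) (α β : Module.Dual ℂ V) :
    ev (ω + ω') α β = ev ω α β + ev ω' α β := by
  simp [ev]

lemma ev_smul_smul (ω : V ⊗[ℂ] V) (a b : ℂ) (α β : Module.Dual ℂ V) :
    ev ω (a • α) (b • β) = a * b * ev ω α β := by
  induction ω using TensorProduct.induction_on with
  | zero => simp [ev]
  | tmul v w => simp only [ev_tmul, LinearMap.smul_apply, smul_eq_mul]; ring
  | add x y hx hy => rw [ev_add, ev_add, hx, hy]; ring

namespace StarQuadratic

variable (D : StarQuadratic V)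

/-- The antilinear involution of `V*` that is the transpose of `j`:
`(j Z)(L) = conj (Z (j L))`. Written `Z ↦ Z̄`. -/
def conj : Module.Dual ℂ V →ₛₗ[starRingEnd ℂ] Module.Dual ℂ V where
  toFun Z :=
    { toFun := fun v => starRingEnd ℂ (Z (D.j v))
      map_add' := fun v w => by simp
      map_smul' := fun c v => by simp }
  map_add' Z Z' := by ext v; simp
  map_smul' c Z := by ext v; simp

@[simp] lemma conj_apply (Z : Module.Dual ℂ V) (v : V) :
    D.conj Z v = starRingEnd ℂ (Z (D.j v)) := rfl

lemma conj_conj (Z : Module.Dual ℂ V) : D.conj (D.conj Z) = Z := by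
  ext v; simp [D.j_j]

/-- The involution `Z ↦ Z̄` of `P(V*)`. -/
def pconj : PDual V → PDual V :=
  Projectivization.map D.conj (Function.LeftInverse.injective D.conj_conj)

/-- The correspondence `Γ ⊆ P(V*) × P(V*)`, the set of pairs on which all relations vanish. -/
def Γ : Set (PDual V × PDual V) := {p | ∀ ω ∈ D.R, ev ω p.1.rep p.2.rep = 0}

/-- The characteristic variety `E`, the first projection of `Γ`. -/
def charVar : Set (PDual V) := Prod.fst '' D.Γ

/-- The permutation `σ` of `E` has graph `Γ`. (In particular the second projection of `Γ` is also
equal to `E`.) -/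
def IsCorrespondence (σ : Equiv.Perm D.charVar) : Prop :=
  ∀ x y : PDual V, (x, y) ∈ D.Γ ↔ ∃ hx : x ∈ D.charVar, (σ ⟨x, hx⟩ : PDual V) = y

/-- `Q` is central on `C ⊆ E × E`: for all `(Z, Z') ∈ C` and all `ω ∈ R`,
`ω(Z, Z') Q(σ(Z'), σ⁻¹(Z)) + Q(Z, Z') ω(σ(Z'), σ⁻¹(Z)) = 0`. The left side is homogeneous in each
of the four points, so that the choice of vectors representing them does not matter. -/
def IsCentralOn (σ : Equiv.Perm D.charVar) (Q : V ⊗[ℂ] V) (C : Set (PDual V × PDual V)) : Prop :=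
  ∀ Z Z' : D.charVar, ((Z : PDual V), (Z' : PDual V)) ∈ C → ∀ ω ∈ D.R,
    ev ω Z.1.rep Z'.1.rep * ev Q (σ Z').1.rep (σ.symm Z).1.rep +
      ev Q Z.1.rep Z'.1.rep * ev ω (σ Z').1.rep (σ.symm Z).1.rep = 0

end StarQuadratic

/-- A compact `σ`-invariant subset `K` of `E`, together with a symmetric `Q ∈ S²(V)` which is
strictly positive on `{(Z, Z̄) ; Z ∈ K}`. This determines the hermitian metric
`⟨L, L'⟩ = L(Z) conj(L'(Z)) / Q(Z, Z̄)` on the restriction to `K` of the dual `ℒ` of the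
tautological line bundle. -/
structure PositiveDatum (D : StarQuadratic V) (σ : Equiv.Perm D.charVar) where
  K : Set D.charVar
  isCompact : @IsCompact _ (projTopology V) (Subtype.val '' K)
  invariant : σ '' K = K
  Q : V ⊗[ℂ] V
  symm : TensorProduct.comm ℂ V V Q = Q
  re_pos : ∀ Z ∈ K, 0 < (ev Q Z.1.rep (D.conj Z.1.rep)).re
  im_zero : ∀ Z ∈ K, (ev Q Z.1.rep (D.conj Z.1.rep)).im = 0

namespace PositiveDatum

variable {D : StarQuadratic V} {σ : Equiv.Perm D.charVar} (X : PositiveDatum D σ)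

/-- `Q(z, z̄)` for `z ∈ V*`. -/
def q (z : Module.Dual ℂ V) : ℂ := ev X.Q z (D.conj z)

/-- The norm `‖Y‖(Z)` at `Z` of the section of `ℒ` given by `Y ∈ V`. -/
def sectionNorm (Y : V) (Z : PDual V) : ℝ := ‖Z.rep Y‖ / √(X.q Z.rep).re

/-- The subset `K` of `P(V*)`. -/
def KP : Set (PDual V) := Subtype.val '' X.K

lemma q_smul (c : ℂ) (z : Module.Dual ℂ V) : X.q (c • z) = ((‖c‖ ^ 2 : ℝ) : ℂ) * X.q z := by
  rw [q, q, LinearMap.map_smulₛₗ, ev_smul_smul, Complex.mul_conj, Complex.normSq_eq_norm_sq]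

lemma continuous_q : @Continuous _ _ (dualTopology V) _ X.q := by
  let _ := dualTopology V
  have hev : ∀ v : V, Continuous (fun z : Module.Dual ℂ V => z v) := fun v =>
    (continuous_apply v).comp continuous_induced_dom
  unfold q
  induction X.Q using TensorProduct.induction_on with
  | zero => simpa [ev] using continuous_const
  | tmul v w =>
    simp only [ev_tmul, StarQuadratic.conj_apply]
    exact (hev v).mul (Complex.continuous_conj.comp (hev _))
  | add a b ha hb =>
    simp only [ev_add]
    exact ha.add hb

/-- The sections of `ℒ` given by vectors of `V` are bounded on `K`. -/
lemma exists_bound (Y : V) : ∃ C : ℝ, 0 ≤ C ∧ ∀ (z : Module.Dual ℂ V) (hz : z ≠ 0),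
    Projectivization.mk ℂ z hz ∈ X.KP → ‖z Y‖ ^ 2 ≤ C * (X.q z).re := by
  let _ := dualTopology V
  let _ := projTopology V
  let U : ℕ → Set (PDual V) := fun n => {Z | ‖Z.rep Y‖ ^ 2 < n * (X.q Z.rep).re}
  have key : ∀ (n : ℕ) (z : Module.Dual ℂ V) (hz : z ≠ 0),
      Projectivization.mk ℂ z hz ∈ U n ↔ ‖z Y‖ ^ 2 < n * (X.q z).re := by
    intro n z hz
    obtain ⟨a, ha⟩ := Projectivization.exists_smul_eq_mk_rep ℂ z hz
    have hpos : 0 < ‖(a : ℂ)‖ ^ 2 := by have := norm_pos_iff.2 a.ne_zero; positivity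
    change ‖(Projectivization.mk ℂ z hz).rep Y‖ ^ 2 < n * (X.q (Projectivization.mk ℂ z hz).rep).re
      ↔ _
    rw [← ha, Units.smul_def, X.q_smul, Complex.re_ofReal_mul, LinearMap.smul_apply, norm_smul,
      mul_pow, mul_left_comm, mul_lt_mul_iff_right₀ hpos]
  have hopen : ∀ n, IsOpen (U n) := by
    intro n
    refine isOpen_coinduced.2 ?_
    have h1 : (fun φ : {φ : Module.Dual ℂ V // φ ≠ 0} => Projectivization.mk' ℂ φ) ⁻¹' U n =
        {φ | ‖φ.1 Y‖ ^ 2 < n * (X.q φ.1).re} := by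
      ext φ
      exact key n φ.1 φ.2
    rw [h1]
    refine isOpen_lt ?_ ?_
    · exact ((((continuous_apply Y).comp continuous_induced_dom).comp
        continuous_subtype_val).norm).pow 2
    · exact continuous_const.mul (Complex.continuous_re.comp
        (X.continuous_q.comp continuous_subtype_val))
  have hcov : X.KP ⊆ ⋃ n, U n := by
    rintro _ ⟨Z, hZ, rfl⟩
    have hp := X.re_pos Z hZ
    obtain ⟨n, hn⟩ := exists_nat_gt (‖Z.1.rep Y‖ ^ 2 / (X.q Z.1.rep).re)
    exact Set.mem_iUnion.2 ⟨n, (div_lt_iff₀ hp).1 hn⟩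
  have hmono : ∀ z : PDual V, z ∈ X.KP → ∀ m n : ℕ, m ≤ n → z ∈ U m → z ∈ U n := by
    rintro _ ⟨Z, hZ, rfl⟩ m n hmn h
    have hp := X.re_pos Z hZ
    have hmn' : (m : ℝ) ≤ n := by exact_mod_cast hmn
    exact lt_of_lt_of_le h (mul_le_mul_of_nonneg_right hmn' hp.le)
  obtain ⟨t, ht⟩ := X.isCompact.elim_finite_subcover U hopen hcov
  refine ⟨(t.sup id : ℕ), by positivity, fun z hz hzK => ?_⟩
  obtain ⟨n, hn, hnz⟩ := Set.mem_iUnion₂.1 (ht hzK)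
  exact ((key _ z hz).1 (hmono _ hzK n _ (Finset.le_sup (f := id) hn) hnz)).le

/-! ## The twisted crossed product `C(K) ×_{σ,ℒ} ℤ`

A *frame* is a choice, along a whole `σ`-orbit `(σᵏ(Z))` in `K`, of unit vectors
`z k` in the lines `σᵏ(Z) ⊂ V*`. At such a frame the fibre at `Z` of
`ℒ_n = ℒ ⊗ ℒ^σ ⊗ ⋯ ⊗ ℒ^{σ^{n-1}}` is trivialised by evaluation at `z 0 ⊗ ⋯ ⊗ z (n-1)`, and the
sections of `ℒ_n` become functions on the space of frames with a given behaviour under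
change of frame. -/

/-- A frame along an orbit of `σ` in `K`. -/
structure Frame where
  pt : ℤ → D.charVar
  pt_mem : ∀ k, pt k ∈ X.K
  pt_succ : ∀ k, pt (k + 1) = σ (pt k)
  vec : ℤ → Module.Dual ℂ V
  vec_ne : ∀ k, vec k ≠ 0
  mk_vec : ∀ k, Projectivization.mk ℂ (vec k) (vec_ne k) = (pt k).1
  unit : ∀ k, X.q (vec k) = 1

variable {X}

namespace Frame

instance : TopologicalSpace X.Frame :=
  TopologicalSpace.induced (fun (z : X.Frame) (p : ℤ × V) => z.vec p.1 p.2) inferInstance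

lemma ext' {z z' : X.Frame} (h : z.vec = z'.vec) : z = z' := by
  have h2 : z.pt = z'.pt := by
    funext k
    apply Subtype.ext
    rw [← z.mk_vec k, ← z'.mk_vec k]
    simp only [h]
  cases z; cases z'
  cases h; cases h2; rfl

/-- The frame `k ↦ z (k + n)`, over the point `σⁿ(Z)`. -/
def shift (n : ℤ) (z : X.Frame) : X.Frame where
  pt k := z.pt (k + n)
  pt_mem k := z.pt_mem _
  pt_succ k := by rw [← z.pt_succ]; congr 1; ring
  vec k := z.vec (k + n)
  vec_ne k := z.vec_ne _
  mk_vec k := z.mk_vec _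
  unit k := z.unit _

@[simp] lemma shift_vec (n k : ℤ) (z : X.Frame) : (z.shift n).vec k = z.vec (k + n) := rfl

lemma shift_zero (z : X.Frame) : z.shift 0 = z := ext' (by funext k; simp)

lemma shift_shift (m n : ℤ) (z : X.Frame) : (z.shift m).shift n = z.shift (m + n) :=
  ext' (by funext k; simp only [shift_vec]; congr 1; ring)

lemma continuous_eval (k : ℤ) (Y : V) : Continuous (fun z : X.Frame => z.vec k Y) :=
  Continuous.comp (g := fun w : ℤ × V → ℂ => w (k, Y)) (continuous_apply (k, Y))
    (continuous_induced_dom (f := fun (z : X.Frame) (p : ℤ × V) => z.vec p.1 p.2))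
lemma continuous_shift (n : ℤ) : Continuous (shift n : X.Frame → X.Frame) :=
  continuous_induced_rng.2 (continuous_pi fun p => continuous_eval (p.1 + n) p.2)

end Frame

variable (X) in
/-- Bounded continuous functions on the space of frames. (This space is compact when
`V` is finite-dimensional, so that all continuous functions are bounded.) -/
abbrev Fun : Type u := X.Frame →ᵇ ℂ

/-- `n : ℤ` acts on functions of frames by `f ↦ f ∘ shift n`, which covers `f ↦ f ∘ σⁿ`. -/
instance : MulSemiringAction (Multiplicative ℤ) X.Fun where
  smul n f := f.compContinuous ⟨Frame.shift n.toAdd, Frame.continuous_shift _⟩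
  one_smul f := by
    ext z
    change f (z.shift 0) = f z
    rw [Frame.shift_zero]
  mul_smul m n f := by
    ext z
    change f (z.shift (m.toAdd + n.toAdd)) = f ((z.shift m.toAdd).shift n.toAdd)
    rw [Frame.shift_shift]
  smul_zero n := rfl
  smul_add n f g := rfl
  smul_one n := rfl
  smul_mul n f g := rfl

lemma smul_fun_apply (n : Multiplicative ℤ) (f : X.Fun) (z : X.Frame) :
    (n • f) z = f (z.shift n.toAdd) := rfl

instance : SMulCommClass (Multiplicative ℤ) ℂ X.Fun where
  smul_comm _ _ _ := rfl

lemma smul_star_fun (n : Multiplicative ℤ) (f : X.Fun) : n • star f = star (n • f) := rfl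

variable (X) in
/-- The algebra of finite sums `∑ f_n Wⁿ`, `f_n` a function on frames, with the crossed product rule
`(f Wᵐ) (g Wⁿ) = f (g ∘ shift m) Wᵐ⁺ⁿ`. -/
abbrev BigAlg : Type u := SkewMonoidAlgebra X.Fun (Multiplicative ℤ)

namespace BigAlg

/-- The map `∑ f_n Wⁿ ↦ ∑ W⁻ⁿ f̄_n`. -/
def starFun (a : X.BigAlg) : X.BigAlg :=
  a.sum fun n f => SkewMonoidAlgebra.single n⁻¹ (n⁻¹ • star f)

lemma starFun_single (n : Multiplicative ℤ) (f : X.Fun) :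
    starFun (SkewMonoidAlgebra.single n f) = SkewMonoidAlgebra.single n⁻¹ (n⁻¹ • star f) :=
  SkewMonoidAlgebra.sum_single_index (by simp)

lemma starFun_add (a b : X.BigAlg) : starFun (a + b) = starFun a + starFun b :=
  SkewMonoidAlgebra.sum_add_index' (by simp) (by simp)

lemma starFun_zero : starFun (0 : X.BigAlg) = 0 := by
  simpa using starFun_single (X := X) 1 0

lemma starFun_starFun (a : X.BigAlg) : starFun (starFun a) = a := by
  induction a using SkewMonoidAlgebra.induction with
  | h0 => simp [starFun_zero]
  | ha n f a _ _ ha =>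
    rw [starFun_add, starFun_add, ha, starFun_single, starFun_single]
    simp [smul_star_fun]

lemma starFun_mul (a b : X.BigAlg) : starFun (a * b) = starFun b * starFun a := by
  induction a using SkewMonoidAlgebra.induction with
  | h0 => simp [starFun_zero]
  | ha n f a _ _ ha =>
    rw [add_mul, starFun_add, ha, starFun_add, mul_add]
    congr 1
    clear ha
    induction b using SkewMonoidAlgebra.induction with
    | h0 => simp [starFun_zero]
    | ha m g b _ _ hb =>
      rw [mul_add, starFun_add, hb, starFun_add, add_mul]
      congr 1
      rw [SkewMonoidAlgebra.single_mul_single, starFun_single, starFun_single, starFun_single,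
        SkewMonoidAlgebra.single_mul_single]
      rw [mul_inv_rev, star_mul, smul_mul', ← smul_star_fun, smul_smul, smul_smul, mul_assoc,
        inv_mul_cancel, mul_one]

/-- The involution, determined by `(f Wⁿ)* = W⁻ⁿ f̄ = (f̄ ∘ shift (-n)) W⁻ⁿ`. -/
instance : StarRing X.BigAlg where
  star := starFun
  star_involutive := starFun_starFun
  star_mul := starFun_mul
  star_add := starFun_add

lemma star_single (n : Multiplicative ℤ) (f : X.Fun) :
    star (SkewMonoidAlgebra.single n f : X.BigAlg) =
      SkewMonoidAlgebra.single n⁻¹ (n⁻¹ • star f) := starFun_single n f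

lemma coeff_star (a : X.BigAlg) (n : Multiplicative ℤ) :
    (star a).coeff n = n • star (a.coeff n⁻¹) := by
  induction a using SkewMonoidAlgebra.induction with
  | h0 => simp
  | ha m f a _ _ ha =>
    rw [star_add, SkewMonoidAlgebra.coeff_add, SkewMonoidAlgebra.coeff_add, Finsupp.add_apply,
      Finsupp.add_apply, ha, star_add, smul_add, star_single]
    congr 1
    classical
    rw [SkewMonoidAlgebra.coeff_single, SkewMonoidAlgebra.coeff_single, Finsupp.single_apply,
      Finsupp.single_apply]
    by_cases h : m⁻¹ = n
    · subst h; simp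
    · rw [if_neg h, if_neg (fun h' => h (by rw [h', inv_inv]))]; simp

instance : StarModule ℂ X.BigAlg where
  star_smul c a := by
    apply SkewMonoidAlgebra.ext
    intro n
    rw [coeff_star, SkewMonoidAlgebra.coeff_smul, SkewMonoidAlgebra.coeff_smul, Finsupp.smul_apply,
      Finsupp.smul_apply, coeff_star, star_smul, smul_comm]

end BigAlg

/-- The character of the group of changes of frames by which `ℒ_n` is associated to the space of
frames: `u 0 ⋯ u (n-1)` for `n ≥ 0`, and the conjugate of `u n ⋯ u (-1)` for `n < 0`. -/
def weight (u : ℤ → ℂ) (n : ℤ) : ℂ :=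
  (∏ k ∈ Finset.Ico 0 n, u k) * ∏ k ∈ Finset.Ico n 0, starRingEnd ℂ (u k)

/-- The function `f` on frames is homogeneous of degree `n`. For `n ≥ 0` these are the
functions `z ↦ ξ(z 0 ⊗ ⋯ ⊗ z (n-1))` with `ξ ∈ C(K, ℒ_n)`, i.e. the coefficients of
the elements `ξ Wⁿ`; for `n = -m < 0` they are the functions
`z ↦ conj (η(z (-m) ⊗ ⋯ ⊗ z (-1)))` with `η ∈ C(K, ℒ_m)`, i.e. the coefficients of the elements
`W*ᵐ η*`. -/
def IsSection (n : ℤ) (f : X.Fun) : Prop :=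
  ∀ (u : ℤ → ℂ) (z z' : X.Frame), (∀ k, z'.vec k = u k • z.vec k) → f z' = weight u n * f z


lemma norm_eq_one {u : ℤ → ℂ} {z z' : X.Frame} (h : ∀ k, z'.vec k = u k • z.vec k) (k : ℤ) :
    ‖u k‖ = 1 := by
  have h1 := z'.unit k
  rw [h k, X.q_smul, z.unit k, mul_one] at h1
  have h2 : ‖u k‖ ^ 2 = 1 := by exact_mod_cast h1
  nlinarith [norm_nonneg (u k)]

lemma weight_zero (u : ℤ → ℂ) : weight u 0 = 1 := by simp [weight]

lemma weight_one (u : ℤ → ℂ) : weight u 1 = u 0 := by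
  have : Finset.Ico (0 : ℤ) 1 = {0} := by decide
  simp [weight, this]

lemma weight_succ {u : ℤ → ℂ} (hu : ∀ k, ‖u k‖ = 1) (n : ℤ) :
    weight u (n + 1) = weight u n * u n := by
  have huu : starRingEnd ℂ (u n) * u n = 1 := by
    rw [mul_comm, Complex.mul_conj, Complex.normSq_eq_norm_sq, hu]; simp
  rcases le_or_gt 0 n with hn | hn
  · have h1 : Finset.Ico 0 (n + 1) = insert n (Finset.Ico 0 n) := by
      ext k; simp only [Finset.mem_Ico, Finset.mem_insert]; omega
    rw [weight, weight, Finset.Ico_eq_empty (by omega : ¬ n + 1 < 0),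
      Finset.Ico_eq_empty (by omega : ¬ n < 0), h1, Finset.prod_insert (by simp)]
    simp [mul_comm]
  · have h1 : Finset.Ico n 0 = insert n (Finset.Ico (n + 1) 0) := by
      ext k; simp only [Finset.mem_Ico, Finset.mem_insert]; omega
    rw [weight, weight, Finset.Ico_eq_empty (by omega : ¬ 0 < n + 1),
      Finset.Ico_eq_empty (by omega : ¬ 0 < n), h1, Finset.prod_insert (by simp)]
    simp only [Finset.prod_empty, one_mul]
    rw [mul_right_comm, huu, one_mul]

lemma weight_add {u : ℤ → ℂ} (hu : ∀ k, ‖u k‖ = 1) (m n : ℤ) :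
    weight u (m + n) = weight u m * weight (fun k => u (k + m)) n := by
  have hv : ∀ k, ‖(fun k => u (k + m)) k‖ = 1 := fun k => hu _
  have hne : ∀ k, u k ≠ 0 := fun k => by rw [← norm_ne_zero_iff, hu]; exact one_ne_zero
  induction n using Int.induction_on with
  | zero => simp [weight_zero]
  | succ n ih =>
    rw [← add_assoc, weight_succ hu, ih, weight_succ hv, mul_assoc, add_comm (n : ℤ) m]
  | pred n ih =>
    have h1 := weight_succ hu (m + (-(n : ℤ) - 1))
    have h2 := weight_succ hv (-(n : ℤ) - 1)
    rw [show m + (-(n : ℤ) - 1) + 1 = m + -n by ring, ih] at h1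
    rw [show -(n : ℤ) - 1 + 1 = -n by ring] at h2
    rw [h2, ← mul_assoc, show -(n : ℤ) - 1 + m = m + (-n - 1) by ring] at h1
    exact (mul_right_cancel₀ (hne _) h1).symm

lemma norm_weight {u : ℤ → ℂ} (hu : ∀ k, ‖u k‖ = 1) (n : ℤ) : ‖weight u n‖ = 1 := by
  simp [weight, norm_prod, hu]

lemma IsSection.zero (n : ℤ) : IsSection n (0 : X.Fun) := by
  intro u z z' _; simp

lemma IsSection.one : IsSection 0 (1 : X.Fun) := by
  intro u z z' _; simp [weight_zero]

lemma IsSection.add {n : ℤ} {f g : X.Fun} (hf : IsSection n f) (hg : IsSection n g) :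
    IsSection n (f + g) := by
  intro u z z' h
  rw [BoundedContinuousFunction.add_apply, BoundedContinuousFunction.add_apply, hf u z z' h,
    hg u z z' h, mul_add]

lemma IsSection.sum {ι : Type*} {n : ℤ} (s : Finset ι) (f : ι → X.Fun)
    (h : ∀ i ∈ s, IsSection n (f i)) : IsSection n (∑ i ∈ s, f i) := by
  classical
  induction s using Finset.induction_on with
  | empty => simpa using IsSection.zero n
  | insert i s hi ih =>
    rw [Finset.sum_insert hi]
    exact (h i (by simp)).add (ih fun k hk => h k (by simp [hk]))

lemma IsSection.smul {n : ℤ} (c : ℂ) {f : X.Fun} (hf : IsSection n f) : IsSection n (c • f) := by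
  intro u z z' h
  rw [BoundedContinuousFunction.smul_apply, BoundedContinuousFunction.smul_apply, hf u z z' h,
    smul_eq_mul, smul_eq_mul, mul_left_comm]

lemma IsSection.mul {m n : Multiplicative ℤ} {f g : X.Fun} (hf : IsSection m.toAdd f)
    (hg : IsSection n.toAdd g) : IsSection (m * n).toAdd (f * m • g) := by
  intro u z z' h
  rw [BoundedContinuousFunction.mul_apply, BoundedContinuousFunction.mul_apply, smul_fun_apply,
    smul_fun_apply, hf u z z' h, hg (fun k => u (k + m.toAdd)) (z.shift m.toAdd) (z'.shift m.toAdd)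
      (fun k => h _), toAdd_mul, weight_add (norm_eq_one h)]
  ring

lemma IsSection.star {n : Multiplicative ℤ} {f : X.Fun} (hf : IsSection (n⁻¹).toAdd f) :
    IsSection n.toAdd (n • star f) := by
  intro u z z' h
  have hu := norm_eq_one h
  rw [smul_fun_apply, smul_fun_apply, BoundedContinuousFunction.star_apply,
    BoundedContinuousFunction.star_apply,
    hf (fun k => u (k + n.toAdd)) (z.shift n.toAdd) (z'.shift n.toAdd) (fun k => h _), star_mul']
  congr 1
  have h1 := weight_add hu n.toAdd (n⁻¹).toAdd
  have h2 : ‖weight (fun k => u (k + n.toAdd)) (n⁻¹).toAdd‖ = 1 := norm_weight (fun k => hu _) _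
  rw [toAdd_inv, add_neg_cancel, weight_zero] at h1
  rw [toAdd_inv] at h2 ⊢
  generalize weight (fun k => u (k + n.toAdd)) (-n.toAdd) = b at *
  have h3 : b * starRingEnd ℂ b = 1 := by
    rw [Complex.mul_conj, Complex.normSq_eq_norm_sq, h2]; simp
  calc starRingEnd ℂ b = (weight u n.toAdd * b) * starRingEnd ℂ b := by rw [← h1, one_mul]
    _ = weight u n.toAdd := by rw [mul_assoc, h3, mul_one]

variable (X) in
/-- The `*`-algebra of finite sums of monomials `ξ Wⁿ` and `W*ⁿ η*` with `ξ, η ∈ C(K, ℒ_n)`. -/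
def algCrossedProduct : StarSubalgebra ℂ X.BigAlg where
  carrier := {a | ∀ n, IsSection n.toAdd (a.coeff n)}
  zero_mem' n := IsSection.zero _
  add_mem' ha hb n := by
    rw [SkewMonoidAlgebra.coeff_add]
    exact (ha n).add (hb n)
  one_mem' n := by
    classical
    rw [SkewMonoidAlgebra.coeff_one, Finsupp.single_apply]
    split_ifs with h
    · subst h; exact IsSection.one
    · exact IsSection.zero _
  mul_mem' {a b} ha hb n := by
    classical
    rw [SkewMonoidAlgebra.coeff_mul]
    refine IsSection.sum _ _ fun m _ => IsSection.sum _ _ fun k _ => ?_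
    dsimp only
    split_ifs with h
    · subst h
      exact (ha m).mul (hb k)
    · exact IsSection.zero _
  algebraMap_mem' c n := by
    classical
    rw [Algebra.algebraMap_eq_smul_one, SkewMonoidAlgebra.coeff_smul, Finsupp.smul_apply,
      SkewMonoidAlgebra.coeff_one, Finsupp.single_apply]
    split_ifs with h
    · subst h; exact IsSection.one.smul c
    · exact (IsSection.zero _).smul c
  star_mem' {a} ha n := by
    rw [BigAlg.coeff_star]
    exact IsSection.star (ha n⁻¹)

namespace algCrossedProduct

/-- The monomial of degree `n` with coefficient `f`. -/
def monomial (n : ℤ) (f : X.Fun) (hf : IsSection n f) : algCrossedProduct X :=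
  ⟨SkewMonoidAlgebra.single (Multiplicative.ofAdd n) f, fun m => by
    classical
    rw [SkewMonoidAlgebra.coeff_single, Finsupp.single_apply]
    split_ifs with h
    · subst h; exact hf
    · exact IsSection.zero _⟩

end algCrossedProduct

variable (X) in
/-- A (unital) involutive representation of the `*`-algebra in a nonzero Hilbert space. -/
structure Rep where
  H : Type u
  [normed : NormedAddCommGroup H]
  [innerProduct : InnerProductSpace ℂ H]
  [complete : CompleteSpace H]
  [nontrivial : Nontrivial H]
  π : algCrossedProduct X →⋆ₐ[ℂ] (H →L[ℂ] H)

attribute [instance] Rep.normed Rep.innerProduct Rep.complete Rep.nontrivial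

lemma Rep.norm_monomial_le (ρ : X.Rep) (n : ℤ) (f : X.Fun) (hf : IsSection n f) :
    ‖ρ.π (algCrossedProduct.monomial n f hf)‖ ≤ ‖f‖ := by
  -- `g = √(‖f‖² - |f|²)` has degree zero, and `g g + (f Wⁿ) (f Wⁿ)* = ‖f‖²`.
  let g : X.Fun := BoundedContinuousFunction.ofNormedAddCommGroup
    (fun z => ((√(‖f‖ ^ 2 - ‖f z‖ ^ 2) : ℝ) : ℂ)) (by fun_prop) ‖f‖ (fun z => by
      rw [Complex.norm_real, Real.norm_of_nonneg (Real.sqrt_nonneg _)]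
      exact Real.sqrt_le_iff.2 ⟨norm_nonneg _, by nlinarith [norm_nonneg (f z)]⟩)
  have hg : IsSection 0 g := by
    intro u z z' h
    have h1 : ‖f z'‖ = ‖f z‖ := by
      rw [hf u z z' h, norm_mul, norm_weight (norm_eq_one h), one_mul]
    rw [weight_zero, one_mul]
    change ((√(‖f‖ ^ 2 - ‖f z'‖ ^ 2) : ℝ) : ℂ) = ((√(‖f‖ ^ 2 - ‖f z‖ ^ 2) : ℝ) : ℂ)
    rw [h1]
  have hgz : ∀ z, g z * g z + f z * starRingEnd ℂ (f z) = ((‖f‖ ^ 2 : ℝ) : ℂ) := by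
    intro z
    have h0 : 0 ≤ ‖f‖ ^ 2 - ‖f z‖ ^ 2 := by
      have := f.norm_coe_le_norm z
      nlinarith [norm_nonneg (f z)]
    change ((√(‖f‖ ^ 2 - ‖f z‖ ^ 2) : ℝ) : ℂ) * ((√(‖f‖ ^ 2 - ‖f z‖ ^ 2) : ℝ) : ℂ) + _ = _
    rw [← Complex.ofReal_mul, Real.mul_self_sqrt h0, Complex.mul_conj, Complex.normSq_eq_norm_sq]
    push_cast
    ring
  have hgs : star g = g := by
    ext z
    exact Complex.conj_ofReal _
  let G : algCrossedProduct X := algCrossedProduct.monomial 0 g hg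
  let F : algCrossedProduct X := algCrossedProduct.monomial n f hf
  have hG : star G = G := by
    apply Subtype.ext
    change star (SkewMonoidAlgebra.single (Multiplicative.ofAdd 0) g : X.BigAlg) = _
    rw [BigAlg.star_single, hgs, ofAdd_zero, inv_one, one_smul]
    rfl
  have key : G * star G + F * star F = ((‖f‖ ^ 2 : ℝ) : ℂ) • (1 : algCrossedProduct X) := by
    rw [hG]
    apply Subtype.ext
    change (SkewMonoidAlgebra.single (Multiplicative.ofAdd 0) g : X.BigAlg) *
      SkewMonoidAlgebra.single (Multiplicative.ofAdd 0) g +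
      SkewMonoidAlgebra.single (Multiplicative.ofAdd n) f *
        star (SkewMonoidAlgebra.single (Multiplicative.ofAdd n) f : X.BigAlg) =
      ((‖f‖ ^ 2 : ℝ) : ℂ) • (SkewMonoidAlgebra.single 1 1 : X.BigAlg)
    rw [BigAlg.star_single, SkewMonoidAlgebra.single_mul_single,
      SkewMonoidAlgebra.single_mul_single, SkewMonoidAlgebra.smul_single, smul_smul,
      mul_inv_cancel, one_smul, ofAdd_zero, one_smul, one_mul, ← SkewMonoidAlgebra.single_add]
    congr 1
    ext z
    change g z * g z + f z * starRingEnd ℂ (f z) = ((‖f‖ ^ 2 : ℝ) : ℂ) * 1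
    rw [hgz, mul_one]
  have key2 := congrArg ρ.π key
  simp only [map_add, map_mul, map_star, map_smul, map_one] at key2
  refine (norm_star (ρ.π F)).symm.le.trans
    (ContinuousLinearMap.opNorm_le_bound _ (norm_nonneg _) fun v => ?_)
  have h1 := congrArg (fun T : ρ.H →L[ℂ] ρ.H => (inner ℂ v (T v)).re) key2
  have h2 : ∀ T : ρ.H →L[ℂ] ρ.H, (inner ℂ v ((T * star T) v)).re = ‖star T v‖ ^ 2 := by
    intro T
    change (inner ℂ v (T (star T v))).re = _
    rw [← ContinuousLinearMap.adjoint_inner_left, ← ContinuousLinearMap.star_eq_adjoint,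
      inner_self_eq_norm_sq_to_K]
    norm_cast
  simp only [_root_.add_apply, inner_add_right, Complex.add_re, h2] at h1
  have h3 : (inner ℂ v ((((‖f‖ ^ 2 : ℝ) : ℂ) • (1 : ρ.H →L[ℂ] ρ.H)) v)).re =
      ‖f‖ ^ 2 * ‖v‖ ^ 2 := by
    change (inner ℂ v (((‖f‖ ^ 2 : ℝ) : ℂ) • v)).re = _
    rw [inner_smul_right, inner_self_eq_norm_sq_to_K, Complex.re_ofReal_mul]
    norm_cast
  rw [h3] at h1
  refine le_of_sq_le_sq ?_ (by positivity)
  rw [mul_pow, ← h1]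
  have : 0 ≤ ‖star (ρ.π G) v‖ ^ 2 := by positivity
  linarith

lemma exists_norm_bound (a : algCrossedProduct X) : ∃ C : ℝ, ∀ ρ : X.Rep, ‖ρ.π a‖ ≤ C := by
  refine ⟨∑ n ∈ a.1.support, ‖a.1.coeff n‖, fun ρ => ?_⟩
  have h : a = ∑ n ∈ a.1.support,
      algCrossedProduct.monomial n.toAdd (a.1.coeff n) (a.2 n) := by
    apply Subtype.ext
    rw [AddSubmonoidClass.coe_finsetSum]
    exact (SkewMonoidAlgebra.sum_single a.1).symm
  conv_lhs => rw [h, map_sum]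
  exact (norm_sum_le _ _).trans (Finset.sum_le_sum fun n _ => ρ.norm_monomial_le _ _ _)

variable (X) in
/-- The bounded families of operators indexed by all representations. -/
abbrev RepFamilies : Type (u + 1) := lp (fun ρ : X.Rep => (ρ.H →L[ℂ] ρ.H)) ∞

instance : CStarAlgebra X.RepFamilies where

variable (X) in
/-- The universal representation of the `*`-algebra: the norm of the image of `a` is the supremum of
`‖π(a)‖` over all involutive representations `π` in Hilbert spaces. -/
def universalRep : algCrossedProduct X →⋆ₐ[ℂ] X.RepFamilies where
  toFun a := ⟨fun ρ => ρ.π a, by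
    obtain ⟨C, hC⟩ := exists_norm_bound a
    exact memℓp_infty ⟨C, by rintro _ ⟨ρ, rfl⟩; exact hC ρ⟩⟩
  map_one' := by ext ρ : 2; exact map_one ρ.π
  map_mul' a b := by ext ρ : 2; exact map_mul ρ.π a b
  map_zero' := by ext ρ : 2; exact map_zero ρ.π
  map_add' a b := by ext ρ : 2; exact map_add ρ.π a b
  commutes' c := by ext ρ : 2; exact AlgHomClass.commutes ρ.π c
  map_star' a := by ext ρ : 2; exact map_star ρ.π a

variable (X) in
/-- The twisted crossed product `C*`-algebra `C(K) ×_{σ,ℒ} ℤ`: the completion of the `*`-algebra in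
the norm `sup ‖π(a)‖`, realised as the norm closure of its image under the universal
representation. -/
abbrev crossedProductSubalgebra : StarSubalgebra ℂ X.RepFamilies :=
  (universalRep X).range.topologicalClosure

variable (X) in
/-- The `C*`-algebra `C(K) ×_{σ,ℒ} ℤ` as a type. -/
def CrossedProduct : Type (u + 1) := crossedProductSubalgebra X

instance : CStarAlgebra X.CrossedProduct :=
  StarSubalgebra.cstarAlgebra (crossedProductSubalgebra X)
    (h_closed := StarSubalgebra.isClosed_topologicalClosure _)

variable (X) in
/-- The canonical `*`-homomorphism of the `*`-algebra to its completion. -/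
def toCrossedProduct : algCrossedProduct X →⋆ₐ[ℂ] X.CrossedProduct where
  toFun a := ⟨universalRep X a, subset_closure ⟨a, rfl⟩⟩
  map_one' := Subtype.ext (map_one (universalRep X))
  map_mul' a b := Subtype.ext (map_mul (universalRep X) a b)
  map_zero' := Subtype.ext (map_zero (universalRep X))
  map_add' a b := Subtype.ext (map_add (universalRep X) a b)
  commutes' c := Subtype.ext (AlgHomClass.commutes (universalRep X) c)
  map_star' a := Subtype.ext (map_star (universalRep X) a)

variable (X) in
/-- The section of `ℒ` given by `Y ∈ V`, as a function on frames. -/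
def sectionFun (Y : V) : X.Fun :=
  BoundedContinuousFunction.ofNormedAddCommGroup (fun z => z.vec 0 Y) (Frame.continuous_eval 0 Y)
    (√(X.exists_bound Y).choose) (fun z => by
      have h := (X.exists_bound Y).choose_spec.2 (z.vec 0) (z.vec_ne 0)
        ⟨z.pt 0, z.pt_mem 0, (z.mk_vec 0).symm⟩
      rw [z.unit 0, Complex.one_re, mul_one] at h
      exact Real.le_sqrt_of_sq_le h)

lemma isSection_sectionFun (Y : V) : IsSection 1 (X.sectionFun Y) := by
  intro u z z' h
  rw [weight_one]
  change z'.vec 0 Y = u 0 * z.vec 0 Y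
  rw [h 0]
  rfl

variable (X) in
/-- The element `Y W` of the crossed product, for `Y ∈ V` viewed as a section of `ℒ`. -/
def sectionW (Y : V) : X.CrossedProduct :=
  X.toCrossedProduct (algCrossedProduct.monomial 1 (X.sectionFun Y) (isSection_sectionFun Y))

end PositiveDatum

end QuadCross

end

/-!
A quadratic element `ω` is mapped to a sum of three components. At a frame `z` along an orbit,
the components of degree `2` and `-2` are, up to the factor `1/2`, the values of `ω` at
`(z 0, z 1)` and at `(z̄ (-1), z̄ (-2))`; for `ω ∈ R` they vanish because these pairs lie over the
correspondence `Γ`, which `(Z, Z') ↦ (Z̄', Z̄)` preserves. The component of degree `0` is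
`ω(z 0, z̄ 0) + ω(z̄ (-1), z (-1))`, and since `Q` is `1` on both pairs, its vanishing for `ω ∈ R` is
the centrality of `Q` at `(Z, Z̄)`, where `σ(Z̄)` is the conjugate of `σ⁻¹(Z)`
(`coeff_tensorHom_tensorTwo`, `tensorHom_rel`).

The upper estimate of the norm is the triangle inequality, as the norm of a monomial is at most
the supremum of its coefficient. For the lower one, every frame gives a representation in `ℓ²(ℤ)`
in which the value of the coefficient of `Wⁿ` is a matrix entry (`orbitRep`, `norm_coeff_le`).

For `θ(Q) = 1`, the degree `0` component of `Q` is `(1 + 1) / 2`, and it has to be shown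
that `Q` vanishes at `(Z, σ(Z))` for `Z` in the component `S`
(`IsCorrespondence.ev_eq_zero_of_isCentralOn`).
Centrality at `(Z, σ(Z))` gives `Q(Z, σ(Z)) ω(σ²(Z), σ⁻¹(Z)) = 0` for all `ω ∈ R`, so that
`Q(Z, σ(Z)) = 0` or `σ⁴(Z) = Z`. Both conditions are closed: as the lines `σ(Z)` are the kernels of
the linear systems `ω(Z, ·) = 0`, Cramer's rule gives `σ`, and hence its powers, locally by
homogeneous polynomials (`exists_smul_eq_cofactor`, `IsCorrespondence.exists_forms`).
Irreducibility of `S` then excludes that each of the two conditions fails somewhere on `S`.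
-/

noncomputable section

namespace QuadCross

/-! ### The orbit representations -/

/-- The Hilbert space `ℓ²(ℤ)`; the index set is lifted to the universe of `V`, in which the
spaces of `PositiveDatum.Rep` have to lie. -/
abbrev EllTwo : Type u := lp (fun _ : ULift.{u} ℤ => ℂ) 2

/-- The translation of `ℤ` by `n`. -/
def addEquiv (n : ℤ) : ULift.{u} ℤ ≃ ULift.{u} ℤ where
  toFun k := ⟨k.down + n⟩
  invFun k := ⟨k.down - n⟩
  left_inv k := by simp
  right_inv k := by simp

/-- The unitary operator `(U_n ψ)(k) = ψ(k + n)` of `ℓ²(ℤ)`. -/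
def translation (n : ℤ) : EllTwo.{u} →L[ℂ] EllTwo.{u} :=
  LinearMap.mkContinuous
    { toFun := fun ψ => ⟨fun k => ψ (addEquiv n k),
        (memℓp_gen_iff (by simp)).2
          (((memℓp_gen_iff (by simp)).1 (lp.memℓp ψ)).comp_injective (addEquiv n).injective)⟩
      map_add' := fun ψ φ => rfl
      map_smul' := fun c ψ => rfl } 1 (fun ψ => by
    rw [one_mul]
    refine lp.norm_le_of_tsum_le (by simp) (norm_nonneg _) (le_of_eq ?_)
    rw [lp.norm_rpow_eq_tsum (by simp)]
    exact (addEquiv n).tsum_eq (fun k => ‖ψ k‖ ^ (2 : ℝ≥0∞).toReal))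

lemma translation_apply (n : ℤ) (ψ : EllTwo.{u}) (k : ULift.{u} ℤ) :
    translation n ψ k = ψ ⟨k.down + n⟩ := rfl

lemma star_translation (n : ℤ) : star (translation.{u} n) = translation (-n) := by
  rw [ContinuousLinearMap.star_eq_adjoint, eq_comm, ContinuousLinearMap.eq_adjoint_iff]
  intro ψ φ
  rw [lp.inner_eq_tsum, lp.inner_eq_tsum, ← (addEquiv.{u} n).tsum_eq]
  refine tsum_congr fun k => ?_
  rw [translation_apply, translation_apply]
  change inner ℂ (ψ ⟨k.down + n + -n⟩) (φ ⟨k.down + n⟩) = _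
  rw [add_neg_cancel_right]

/-- The unitary representation of `ℤ` in `ℓ²(ℤ)` by translations. -/
def translationHom : Multiplicative ℤ →* (EllTwo.{u} →L[ℂ] EllTwo.{u}) where
  toFun n := translation n.toAdd
  map_one' := by
    ext ψ k
    rw [translation_apply]
    simp
  map_mul' m n := by
    ext ψ k
    rw [mul_apply_eq_comp, translation_apply, translation_apply, translation_apply,
      toAdd_mul, add_assoc]

namespace PositiveDatum

variable {V : Type u} [AddCommGroup V] [Module ℂ V]
variable {D : StarQuadratic V} {σ : Equiv.Perm D.charVar} {X : PositiveDatum D σ}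

/-- The operator of multiplication by the values of `f` along the orbit of the frame `z`:
`(M_f ψ)(k) = f(z shifted by k) ψ(k)`. -/
def multiplication (z : X.Frame) (f : X.Fun) : EllTwo.{u} →L[ℂ] EllTwo.{u} :=
  have bound (ψ : EllTwo.{u}) (k : ULift.{u} ℤ) :
      ‖f (z.shift k.down) * ψ k‖ ≤ ‖(((‖f‖ : ℝ) : ℂ) • ψ : EllTwo.{u}) k‖ := by
    rw [norm_mul, lp.coeFn_smul, Pi.smul_apply, norm_smul, Complex.norm_real, norm_norm]
    exact mul_le_mul_of_nonneg_right (f.norm_coe_le_norm _) (norm_nonneg _)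
  LinearMap.mkContinuous
    { toFun := fun ψ => ⟨fun k => f (z.shift k.down) * ψ k,
        (lp.memℓp (((‖f‖ : ℝ) : ℂ) • ψ)).mono' (bound ψ)⟩
      map_add' := fun ψ φ => by
        ext k
        change f (z.shift k.down) * (ψ k + φ k) =
          f (z.shift k.down) * ψ k + f (z.shift k.down) * φ k
        rw [mul_add]
      map_smul' := fun c ψ => by
        ext k
        change f (z.shift k.down) * (c * ψ k) = c * (f (z.shift k.down) * ψ k)
        rw [mul_left_comm] } ‖f‖ (fun ψ => by
    refine (lp.norm_mono (by simp) (bound ψ)).trans ?_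
    rw [norm_smul, Complex.norm_real, norm_norm])

lemma multiplication_apply (z : X.Frame) (f : X.Fun) (ψ : EllTwo.{u}) (k : ULift.{u} ℤ) :
    multiplication z f ψ k = f (z.shift k.down) * ψ k := rfl

lemma star_multiplication (z : X.Frame) (f : X.Fun) :
    star (multiplication z f) = multiplication z (star f) := by
  rw [ContinuousLinearMap.star_eq_adjoint, eq_comm, ContinuousLinearMap.eq_adjoint_iff]
  intro ψ φ
  rw [lp.inner_eq_tsum, lp.inner_eq_tsum]
  refine tsum_congr fun k => ?_
  rw [multiplication_apply, multiplication_apply, BoundedContinuousFunction.star_apply,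
    RCLike.inner_apply, RCLike.inner_apply, map_mul]
  simp only [RCLike.star_def, RingHomCompTriple.comp_apply, RingHom.id_apply]
  ring

/-- Multiplication operators form a representation of the functions on frames. -/
def multiplicationHom (z : X.Frame) : X.Fun →ₐ[ℂ] (EllTwo.{u} →L[ℂ] EllTwo.{u}) where
  toFun := multiplication z
  map_one' := by ext ψ k; exact one_mul _
  map_mul' f g := by ext ψ k; exact mul_assoc _ _ _
  map_zero' := by ext ψ k; exact zero_mul _
  map_add' f g := by ext ψ k; exact add_mul _ _ _
  commutes' c := by
    ext ψ k
    rw [multiplication_apply, Algebra.algebraMap_eq_smul_one, Algebra.algebraMap_eq_smul_one,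
      BoundedContinuousFunction.smul_apply]
    change c * 1 * ψ k = c * ψ k
    rw [mul_one]

/-- The representation of the algebra of all `∑ f_n Wⁿ` in `ℓ²(ℤ)` attached to a frame `z`:
`f Wⁿ` acts by `ψ ↦ (k ↦ f(z shifted by k) ψ(k + n))`. -/
def bigOrbitRep (z : X.Frame) : X.BigAlg →ₐ[ℂ] (EllTwo.{u} →L[ℂ] EllTwo.{u}) :=
  SkewMonoidAlgebra.liftNCAlgHom (multiplicationHom z) translationHom (by
    intro f n
    ext ψ k
    rw [mul_apply_eq_comp, mul_apply_eq_comp]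
    change (n • f) (z.shift k.down) * ψ ⟨k.down + n.toAdd⟩ =
      f (z.shift (k.down + n.toAdd)) * ψ ⟨k.down + n.toAdd⟩
    rw [smul_fun_apply, Frame.shift_shift])

lemma bigOrbitRep_single (z : X.Frame) (n : Multiplicative ℤ) (f : X.Fun) :
    bigOrbitRep z (SkewMonoidAlgebra.single n f) = multiplication z f * translation n.toAdd :=
  SkewMonoidAlgebra.liftNC_single _ _ _ _

lemma bigOrbitRep_star (z : X.Frame) (a : X.BigAlg) :
    bigOrbitRep z (star a) = star (bigOrbitRep z a) := by
  induction a using SkewMonoidAlgebra.induction with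
  | h0 => rw [star_zero, map_zero, star_zero]
  | ha n f a _ _ ha =>
    rw [star_add, map_add, map_add, star_add, ha, BigAlg.star_single, bigOrbitRep_single,
      bigOrbitRep_single, star_mul, star_translation, star_multiplication]
    congr 1
    ext ψ k
    rw [mul_apply_eq_comp, mul_apply_eq_comp, multiplication_apply,
      translation_apply, translation_apply, multiplication_apply, smul_fun_apply,
      Frame.shift_shift, toAdd_inv]

/-- The representation of the `*`-algebra attached to a frame. -/
def orbitRep (z : X.Frame) : X.Rep where
  H := EllTwo.{u}
  nontrivial := ⟨lp.single 2 ⟨0⟩ 1, 0, fun h => by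
    have := congrArg (fun ψ : EllTwo.{u} => ψ ⟨0⟩) h
    simp at this⟩
  π :=
    { (bigOrbitRep z).comp (algCrossedProduct X).subtype.toAlgHom with
      map_star' := fun a => bigOrbitRep_star z a.1 }

lemma norm_rep_le (ρ : X.Rep) (a : algCrossedProduct X) :
    ‖ρ.π a‖ ≤ ‖X.toCrossedProduct a‖ :=
  lp.norm_apply_le_norm ENNReal.top_ne_zero (universalRep X a) ρ

/-- The coefficients of an element of the crossed product are bounded by its norm. -/
lemma norm_coeff_le (a : algCrossedProduct X) (n : Multiplicative ℤ) (z : X.Frame) :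
    ‖a.1.coeff n z‖ ≤ ‖X.toCrossedProduct a‖ := by
  classical
  -- the coefficient is the matrix entry `⟨δ₀, π_z(a) δ_n⟩`
  let δ : EllTwo.{u} := lp.single 2 ⟨n.toAdd⟩ 1
  have key : ∀ b : X.BigAlg, bigOrbitRep z b δ ⟨0⟩ = b.coeff n z := by
    intro b
    induction b using SkewMonoidAlgebra.induction with
    | h0 => simp
    | ha m f b _ _ hb =>
      rw [map_add, SkewMonoidAlgebra.coeff_add, Finsupp.add_apply,
        BoundedContinuousFunction.add_apply, ← hb, bigOrbitRep_single]
      change f (z.shift 0) * δ ⟨0 + m.toAdd⟩ + _ = _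
      congr 1
      rw [SkewMonoidAlgebra.coeff_single, Finsupp.single_apply, Frame.shift_zero, zero_add]
      by_cases h : m = n
      · subst h; simp [δ]
      · rw [if_neg h]
        have : (⟨m.toAdd⟩ : ULift.{u} ℤ) ≠ ⟨n.toAdd⟩ := fun h' => h (by simpa using h')
        simp [δ, Pi.single_eq_of_ne this]
  have hδ : ‖δ‖ = 1 := by
    rw [lp.norm_single (by simp)]; simp
  rw [← key a.1]
  refine (lp.norm_apply_le_norm (by simp) _ _).trans ?_
  refine (ContinuousLinearMap.le_opNorm _ _).trans ?_
  rw [hδ, mul_one]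
  exact norm_rep_le (orbitRep z) a

lemma norm_toCrossedProduct_monomial_le (n : ℤ) (f : X.Fun) (hf : IsSection n f) :
    ‖X.toCrossedProduct (algCrossedProduct.monomial n f hf)‖ ≤ ‖f‖ :=
  lp.norm_le_of_forall_le (norm_nonneg _) fun ρ => ρ.norm_monomial_le n f hf

end PositiveDatum

end QuadCross

namespace QuadCross

variable {V : Type u} [AddCommGroup V] [Module ℂ V]

/-! ### Conjugation and the correspondence -/

lemma ev_comm (ω : V ⊗[ℂ] V) (α β : Module.Dual ℂ V) :
    ev (TensorProduct.comm ℂ V V ω) α β = ev ω β α := by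
  induction ω using TensorProduct.induction_on with
  | zero => simp [ev]
  | tmul v w => rw [TensorProduct.comm_tmul, ev_tmul, ev_tmul, mul_comm]
  | add x y hx hy => rw [map_add, ev_add, ev_add, hx, hy]

lemma ev_map_j (D : StarQuadratic V) (ω : V ⊗[ℂ] V) (α β : Module.Dual ℂ V) :
    ev (TensorProduct.map D.j D.j ω) α β = starRingEnd ℂ (ev ω (D.conj α) (D.conj β)) := by
  induction ω using TensorProduct.induction_on with
  | zero => simp [ev]
  | tmul v w => simp [ev_tmul]
  | add x y hx hy => rw [map_add, ev_add, ev_add, hx, hy, map_add]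

/-- The vanishing of `ω` at two points does not depend on the vectors representing them. -/
lemma ev_rep_eq_zero_iff (ω : V ⊗[ℂ] V) {a b : Module.Dual ℂ V} (ha : a ≠ 0) (hb : b ≠ 0) :
    ev ω (Projectivization.mk ℂ a ha).rep (Projectivization.mk ℂ b hb).rep = 0 ↔
      ev ω a b = 0 := by
  obtain ⟨s, hs⟩ := Projectivization.exists_smul_eq_mk_rep ℂ a ha
  obtain ⟨t, ht⟩ := Projectivization.exists_smul_eq_mk_rep ℂ b hb
  rw [← hs, ← ht, Units.smul_def, Units.smul_def, ev_smul_smul]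
  simp

namespace StarQuadratic

variable {D : StarQuadratic V} {σ : Equiv.Perm D.charVar}

lemma conj_ne_zero {a : Module.Dual ℂ V} (ha : a ≠ 0) : D.conj a ≠ 0 := fun h =>
  ha (by rw [← D.conj_conj a, h, map_zero])

lemma pconj_mk {a : Module.Dual ℂ V} (ha : a ≠ 0) :
    D.pconj (Projectivization.mk ℂ a ha) = Projectivization.mk ℂ (D.conj a) (conj_ne_zero ha) :=
  rfl

lemma pconj_pconj (Z : PDual V) : D.pconj (D.pconj Z) = Z := by
  induction Z using Projectivization.ind with
  | h a ha =>
    rw [pconj_mk, pconj_mk]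
    simp only [D.conj_conj]

lemma mk_mem_Γ {a b : Module.Dual ℂ V} (ha : a ≠ 0) (hb : b ≠ 0) :
    (Projectivization.mk ℂ a ha, Projectivization.mk ℂ b hb) ∈ D.Γ ↔ ∀ ω ∈ D.R, ev ω a b = 0 :=
  forall₂_congr fun ω _ => ev_rep_eq_zero_iff ω ha hb

/-- The condition `(j ⊗ j)(R) = t(R)` makes `(Z, Z') ↦ (Z̄', Z̄)` preserve the correspondence. -/
lemma pconj_mem_Γ {x y : PDual V} (h : (x, y) ∈ D.Γ) : (D.pconj y, D.pconj x) ∈ D.Γ := by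
  induction x using Projectivization.ind with
  | h a ha =>
  induction y using Projectivization.ind with
  | h b hb =>
  rw [mk_mem_Γ] at h
  rw [pconj_mk, pconj_mk, mk_mem_Γ]
  intro ω hω
  have h1 : TensorProduct.map D.j D.j ω ∈ D.R.map (TensorProduct.map D.j D.j) :=
    Submodule.mem_map_of_mem hω
  rw [D.map_j_eq_map_flip] at h1
  obtain ⟨ω', hω', h2⟩ := h1
  have h3 := ev_map_j D ω b a
  rw [← h2] at h3
  have h4 : ev ω' a b = starRingEnd ℂ (ev ω (D.conj b) (D.conj a)) := by
    rw [← h3]; exact (ev_comm ω' b a).symm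
  rw [h ω' hω'] at h4
  simpa using h4.symm

lemma IsCorrespondence.mem_Γ (hσ : D.IsCorrespondence σ) (Z : D.charVar) :
    ((Z : PDual V), (σ Z : PDual V)) ∈ D.Γ := (hσ _ _).2 ⟨Z.2, rfl⟩

lemma IsCorrespondence.eq_of_mem_Γ (hσ : D.IsCorrespondence σ) {x y : D.charVar}
    (h : ((x : PDual V), (y : PDual V)) ∈ D.Γ) : σ x = y := by
  obtain ⟨hx, h⟩ := (hσ _ _).1 h
  exact Subtype.ext h

lemma IsCorrespondence.pconj_mem (hσ : D.IsCorrespondence σ) (Z : D.charVar) :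
    D.pconj Z ∈ D.charVar := by
  have h := hσ.mem_Γ (σ.symm Z)
  rw [σ.apply_symm_apply] at h
  exact ⟨_, pconj_mem_Γ h, rfl⟩

/-- Conjugation intertwines `σ` and `σ⁻¹`. -/
lemma IsCorrespondence.apply_pconj (hσ : D.IsCorrespondence σ) (Z : D.charVar) :
    σ ⟨D.pconj (σ Z), hσ.pconj_mem _⟩ = ⟨D.pconj Z, hσ.pconj_mem _⟩ :=
  hσ.eq_of_mem_Γ (pconj_mem_Γ (hσ.mem_Γ Z))

/-- The centrality relation, evaluated on arbitrary vectors in the four lines. -/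
lemma IsCentralOn.mk {Q : V ⊗[ℂ] V} {C : Set (PDual V × PDual V)} (h : D.IsCentralOn σ Q C)
    {Z Z' : D.charVar} (hC : ((Z : PDual V), (Z' : PDual V)) ∈ C) {ω : V ⊗[ℂ] V} (hω : ω ∈ D.R)
    {a b c d : Module.Dual ℂ V} (ha : a ≠ 0) (hb : b ≠ 0) (hc : c ≠ 0) (hd : d ≠ 0)
    (haZ : Projectivization.mk ℂ a ha = Z) (hbZ : Projectivization.mk ℂ b hb = Z')
    (hcZ : Projectivization.mk ℂ c hc = σ Z') (hdZ : Projectivization.mk ℂ d hd = σ.symm Z) :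
    ev ω a b * ev Q c d + ev Q a b * ev ω c d = 0 := by
  have h1 := h Z Z' hC ω hω
  rw [← haZ, ← hbZ, ← hcZ, ← hdZ] at h1
  obtain ⟨s, hs⟩ := Projectivization.exists_smul_eq_mk_rep ℂ a ha
  obtain ⟨t, ht⟩ := Projectivization.exists_smul_eq_mk_rep ℂ b hb
  obtain ⟨p, hp⟩ := Projectivization.exists_smul_eq_mk_rep ℂ c hc
  obtain ⟨r, hr⟩ := Projectivization.exists_smul_eq_mk_rep ℂ d hd
  rw [← hs, ← ht, ← hp, ← hr, Units.smul_def, Units.smul_def, Units.smul_def, Units.smul_def,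
    ev_smul_smul, ev_smul_smul, ev_smul_smul, ev_smul_smul] at h1
  have h2 : ((s : ℂ) * t * p * r) * (ev ω a b * ev Q c d + ev Q a b * ev ω c d) = 0 := by
    linear_combination h1
  simpa using h2

end StarQuadratic

namespace PositiveDatum

variable {D : StarQuadratic V} {σ : Equiv.Perm D.charVar} {X : PositiveDatum D σ}

lemma q_conj (z : Module.Dual ℂ V) : X.q (D.conj z) = X.q z := by
  rw [q, q, D.conj_conj, ← ev_comm, X.symm]

/-! ### Frames -/

namespace Frame

lemma ev_succ (z : X.Frame) (hσ : D.IsCorrespondence σ) {ω : V ⊗[ℂ] V} (hω : ω ∈ D.R) (k : ℤ) :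
    ev ω (z.vec k) (z.vec (k + 1)) = 0 := by
  refine (StarQuadratic.mk_mem_Γ (z.vec_ne k) (z.vec_ne (k + 1))).1 ?_ ω hω
  rw [z.mk_vec, z.mk_vec, z.pt_succ]
  exact hσ.mem_Γ _

lemma ev_conj_succ (z : X.Frame) (hσ : D.IsCorrespondence σ) {ω : V ⊗[ℂ] V} (hω : ω ∈ D.R)
    (k : ℤ) : ev ω (D.conj (z.vec (k + 1))) (D.conj (z.vec k)) = 0 := by
  refine (StarQuadratic.mk_mem_Γ (StarQuadratic.conj_ne_zero (z.vec_ne (k + 1)))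
    (StarQuadratic.conj_ne_zero (z.vec_ne k))).1 ?_ ω hω
  rw [← StarQuadratic.pconj_mk (z.vec_ne _), ← StarQuadratic.pconj_mk (z.vec_ne _)]
  refine StarQuadratic.pconj_mem_Γ ?_
  rw [z.mk_vec, z.mk_vec, z.pt_succ]
  exact hσ.mem_Γ _

/-- Since `Q` takes the value `1` on the pairs `(z k, z̄ k)`, centrality at the point of `z (k + 1)`
says that the two contributions of a relation in degree zero cancel. -/
lemma ev_add_ev_eq_zero (z : X.Frame) (hσ : D.IsCorrespondence σ)
    (hcentral : D.IsCentralOn σ X.Q {p | p.1 ∈ X.KP ∧ p.2 = D.pconj p.1})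
    {ω : V ⊗[ℂ] V} (hω : ω ∈ D.R) (k : ℤ) :
    ev ω (z.vec (k + 1)) (D.conj (z.vec (k + 1))) + ev ω (D.conj (z.vec k)) (z.vec k) = 0 := by
  have hp : D.pconj (z.pt (k + 1)) =
      Projectivization.mk ℂ (D.conj (z.vec (k + 1)))
        (StarQuadratic.conj_ne_zero (z.vec_ne (k + 1))) := by
    rw [← StarQuadratic.pconj_mk (z.vec_ne _), z.mk_vec]
  have h := hcentral.mk (Z := z.pt (k + 1)) (Z' := ⟨_, hσ.pconj_mem (z.pt (k + 1))⟩)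
    ⟨⟨_, z.pt_mem _, rfl⟩, rfl⟩ hω (z.vec_ne (k + 1))
    (StarQuadratic.conj_ne_zero (z.vec_ne (k + 1)))
    (StarQuadratic.conj_ne_zero (z.vec_ne k)) (z.vec_ne k) (z.mk_vec _) hp.symm
    (by
      have h1 := congrArg Subtype.val (hσ.apply_pconj (z.pt k))
      simp only [← z.pt_succ] at h1
      rw [h1, ← StarQuadratic.pconj_mk (z.vec_ne _), z.mk_vec])
    (by rw [z.mk_vec, z.pt_succ, σ.symm_apply_apply])
  have h1 : ev X.Q (z.vec (k + 1)) (D.conj (z.vec (k + 1))) = 1 := z.unit _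
  have h2 : ev X.Q (D.conj (z.vec k)) (z.vec k) = 1 := by
    rw [← ev_comm, X.symm]; exact z.unit k
  rw [h1, h2, mul_one, one_mul] at h
  exact h

variable (X) in
/-- Every point of `K` is the base point of a frame. -/
lemma exists_pt_zero (Z : D.charVar) (hZ : Z ∈ X.K) : ∃ z : X.Frame, z.pt 0 = Z := by
  have hmem : ∀ k : ℤ, (σ ^ k) Z ∈ X.K := by
    intro k
    induction k using Int.induction_on with
    | zero => simpa using hZ
    | succ n ih =>
      rw [add_comm, zpow_one_add, Equiv.Perm.mul_apply, ← X.invariant]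
      exact Set.mem_image_of_mem _ ih
    | pred n ih =>
      rw [sub_eq_neg_add, zpow_add, Equiv.Perm.mul_apply]
      rw [← X.invariant] at ih
      obtain ⟨y, hy, h⟩ := ih
      rw [← h, zpow_neg_one, Equiv.Perm.inv_def, Equiv.symm_apply_apply]
      exact hy
  let c : ℤ → ℝ := fun k => (√(X.q ((σ ^ k) Z).1.rep).re)⁻¹
  have hc : ∀ k, c k ≠ 0 := fun k =>
    inv_ne_zero (Real.sqrt_ne_zero'.2 (X.re_pos _ (hmem k)))
  refine ⟨⟨fun k => (σ ^ k) Z, hmem, fun k => ?_, fun k => (c k : ℂ) • ((σ ^ k) Z).1.rep,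
    fun k => ?_, fun k => ?_, fun k => ?_⟩, by simp⟩
  · rw [add_comm, zpow_one_add, Equiv.Perm.mul_apply]
  · exact smul_ne_zero (by exact_mod_cast hc k) (Projectivization.rep_nonzero _)
  · conv_rhs => rw [← Projectivization.mk_rep ((σ ^ k) Z).1]
    rw [Projectivization.mk_eq_mk_iff']
    exact ⟨c k, rfl⟩
  · have hpos : 0 < (X.q ((σ ^ k) Z).1.rep).re := X.re_pos _ (hmem k)
    have h1 : X.q ((σ ^ k) Z).1.rep = ((X.q ((σ ^ k) Z).1.rep).re : ℂ) :=
      Complex.ext rfl (X.im_zero _ (hmem k))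
    rw [q_smul, Complex.norm_real, h1, ← Complex.ofReal_mul]
    simp only [c, norm_inv, Real.norm_eq_abs, inv_pow, sq_abs, Real.sq_sqrt hpos.le]
    rw [inv_mul_cancel₀ hpos.ne', Complex.ofReal_one]

end Frame

/-- The norm of a section does not depend on the vector representing the point. -/
lemma sectionNorm_mk (Y : V) {a : Module.Dual ℂ V} (ha : a ≠ 0) :
    X.sectionNorm Y (Projectivization.mk ℂ a ha) = ‖a Y‖ / √(X.q a).re := by
  obtain ⟨s, hs⟩ := Projectivization.exists_smul_eq_mk_rep ℂ a ha
  have h0 : (0 : ℝ) < ‖(s : ℂ)‖ := norm_pos_iff.2 s.ne_zero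
  rw [sectionNorm, ← hs, Units.smul_def, q_smul, Complex.re_ofReal_mul, Real.sqrt_mul (by positivity),
    Real.sqrt_sq h0.le, LinearMap.smul_apply, norm_smul, mul_div_mul_left _ _ h0.ne']

lemma sectionNorm_pt (Y : V) (z : X.Frame) (k : ℤ) :
    X.sectionNorm Y (z.pt k) = ‖z.vec k Y‖ := by
  rw [← z.mk_vec k, sectionNorm_mk, z.unit]
  simp

lemma sectionNorm_j (Y : V) (Z : PDual V) :
    X.sectionNorm (D.j Y) Z = X.sectionNorm Y (D.pconj Z) := by
  induction Z using Projectivization.ind with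
  | h a ha =>
    rw [StarQuadratic.pconj_mk, sectionNorm_mk, sectionNorm_mk, q_conj, D.conj_apply,
      RCLike.norm_conj]

lemma bddAbove_sectionNorm (Y : V) : BddAbove (Set.range fun Z : X.KP => X.sectionNorm Y Z) := by
  refine ⟨‖X.sectionFun Y‖, ?_⟩
  rintro _ ⟨⟨_, Z, hZ, rfl⟩, rfl⟩
  obtain ⟨z, rfl⟩ := Frame.exists_pt_zero X Z hZ
  change X.sectionNorm Y (z.pt 0) ≤ _
  rw [sectionNorm_pt]
  exact (X.sectionFun Y).norm_coe_le_norm z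

lemma sectionNorm_nonneg (Y : V) (Z : PDual V) : 0 ≤ X.sectionNorm Y Z :=
  div_nonneg (norm_nonneg _) (Real.sqrt_nonneg _)

lemma norm_sectionFun_le (Y : V) : ‖X.sectionFun Y‖ ≤ ⨆ Z : X.KP, X.sectionNorm Y Z := by
  refine (BoundedContinuousFunction.norm_le (Real.iSup_nonneg fun Z => sectionNorm_nonneg Y _)).2
    fun z => ?_
  change ‖z.vec 0 Y‖ ≤ _
  rw [← sectionNorm_pt]
  exact le_ciSup (bddAbove_sectionNorm Y) (⟨z.pt 0, z.pt 0, z.pt_mem 0, rfl⟩ : X.KP)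

lemma iSup_sectionNorm_j (Y : V) (h : D.j Y = Y ∨ D.pconj '' X.KP = X.KP) :
    ⨆ Z : X.KP, X.sectionNorm (D.j Y) Z = ⨆ Z : X.KP, X.sectionNorm Y Z := by
  rcases h with h | h
  · rw [h]
  · have hmem : ∀ Z ∈ X.KP, D.pconj Z ∈ X.KP := fun Z hZ => h ▸ Set.mem_image_of_mem _ hZ
    let e : X.KP ≃ X.KP :=
      { toFun := fun Z => ⟨D.pconj Z, hmem _ Z.2⟩
        invFun := fun Z => ⟨D.pconj Z, hmem _ Z.2⟩
        left_inv := fun Z => Subtype.ext (StarQuadratic.pconj_pconj _)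
        right_inv := fun Z => Subtype.ext (StarQuadratic.pconj_pconj _) }
    exact (iSup_congr fun Z : X.KP => sectionNorm_j Y Z.1).trans
      (e.iSup_comp (g := fun Z : X.KP => X.sectionNorm Y Z))

end PositiveDatum

end QuadCross

namespace QuadCross

variable {V : Type u} [AddCommGroup V] [Module ℂ V]

namespace PositiveDatum

variable {D : StarQuadratic V} {σ : Equiv.Perm D.charVar} {X : PositiveDatum D σ}

/-! ### The homomorphism to the crossed product -/

variable (X) in
/-- The element `Y W` of the `*`-algebra. -/
def algSectionW (Y : V) : algCrossedProduct X :=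
  algCrossedProduct.monomial 1 (X.sectionFun Y) (isSection_sectionFun Y)

variable (X) in
/-- The coefficient of `W⁻¹` in `W* Ȳ*`: the function `z ↦ ⟨Y, conj (z (-1))⟩` on frames. -/
def conjSectionFun (Y : V) : X.Fun :=
  (Multiplicative.ofAdd (-1 : ℤ)) • star (X.sectionFun (D.j Y))

lemma sectionFun_apply (Y : V) (z : X.Frame) : X.sectionFun Y z = z.vec 0 Y := rfl

lemma conjSectionFun_apply (Y : V) (z : X.Frame) :
    X.conjSectionFun Y z = D.conj (z.vec (-1)) Y := by
  change star (X.sectionFun (D.j Y) (z.shift (-1))) = _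
  rw [sectionFun_apply, Frame.shift_vec, zero_add]
  rfl

variable (X) in
/-- The linear map `Y ↦ (Y W + W* Ȳ*) / √2`. -/
def genMap : V →ₗ[ℂ] algCrossedProduct X where
  toFun Y := ((√2 : ℝ) : ℂ)⁻¹ • (X.algSectionW Y + star (X.algSectionW (D.j Y)))
  map_add' Y Y' := by
    rw [← smul_add]
    congr 1
    have h : ∀ Y Y', X.algSectionW (Y + Y') = X.algSectionW Y + X.algSectionW Y' := by
      intro Y Y'
      apply Subtype.ext
      change SkewMonoidAlgebra.single _ _ =
        SkewMonoidAlgebra.single _ _ + SkewMonoidAlgebra.single _ _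
      rw [← SkewMonoidAlgebra.single_add]
      congr 1
      ext z
      exact map_add (z.vec 0) _ _
    rw [map_add, h, h, star_add, add_add_add_comm]
  map_smul' c Y := by
    rw [RingHom.id_apply, smul_comm c]
    congr 1
    have h : ∀ (c : ℂ) (Y : V), X.algSectionW (c • Y) = c • X.algSectionW Y := by
      intro c Y
      apply Subtype.ext
      change SkewMonoidAlgebra.single _ _ = c • SkewMonoidAlgebra.single _ _
      rw [SkewMonoidAlgebra.smul_single]
      congr 1
      ext z
      exact map_smul (z.vec 0) _ _
    rw [LinearMap.map_smulₛₗ, h, h, star_smul, smul_add, starRingEnd_apply, star_star]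

lemma sqrt_two_smul_genMap (Y : V) :
    ((√2 : ℝ) : ℂ) • X.genMap Y = X.algSectionW Y + star (X.algSectionW (D.j Y)) :=
  smul_inv_smul₀ (by norm_cast; positivity) _

lemma star_genMap (Y : V) : star (X.genMap Y) = X.genMap (D.j Y) := by
  have hs : star (((√2 : ℝ) : ℂ)⁻¹) = ((√2 : ℝ) : ℂ)⁻¹ := by
    rw [← Complex.ofReal_inv]
    exact Complex.conj_ofReal _
  have h : ∀ Y, X.genMap Y =
      ((√2 : ℝ) : ℂ)⁻¹ • (X.algSectionW Y + star (X.algSectionW (D.j Y))) := fun _ => rfl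
  rw [h, h, star_smul, star_add, star_star, D.j_j, add_comm, hs]

lemma coe_genMap (Y : V) :
    (X.genMap Y : X.BigAlg) = ((√2 : ℝ) : ℂ)⁻¹ •
      (SkewMonoidAlgebra.single (Multiplicative.ofAdd 1) (X.sectionFun Y) +
        SkewMonoidAlgebra.single (Multiplicative.ofAdd (-1)) (X.conjSectionFun Y)) := by
  change ((√2 : ℝ) : ℂ)⁻¹ • (SkewMonoidAlgebra.single (Multiplicative.ofAdd 1) (X.sectionFun Y) +
    star (SkewMonoidAlgebra.single (Multiplicative.ofAdd 1) (X.sectionFun (D.j Y)) : X.BigAlg)) = _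
  rw [BigAlg.star_single]
  rfl

variable (X) in
/-- The homomorphism from `T(V)` to the `*`-algebra of finite sums given by
`Y ↦ (Y W + W* Ȳ*) / √2`. -/
def tensorHom : TensorAlgebra ℂ V →ₐ[ℂ] algCrossedProduct X := TensorAlgebra.lift ℂ X.genMap

/-- The image of a quadratic element has components of degree `2`, `0` and `-2` only. -/
lemma coeff_tensorHom_tensorTwo (ω : V ⊗[ℂ] V) (n : Multiplicative ℤ) (z : X.Frame) :
    (X.tensorHom (tensorTwo V ω) : X.BigAlg).coeff n z = 2⁻¹ *
      ((if n = Multiplicative.ofAdd 2 then ev ω (z.vec 0) (z.vec 1) else 0) +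
        (if n = 1 then ev ω (z.vec 0) (D.conj (z.vec 0)) +
          ev ω (D.conj (z.vec (-1))) (z.vec (-1)) else 0) +
        (if n = Multiplicative.ofAdd (-2) then
          ev ω (D.conj (z.vec (-1))) (D.conj (z.vec (-2))) else 0)) := by
  classical
  induction ω using TensorProduct.induction_on with
  | zero => simp [ev]
  | add a b ha hb =>
    rw [map_add, map_add]
    change ((X.tensorHom (tensorTwo V a) : X.BigAlg) +
      (X.tensorHom (tensorTwo V b) : X.BigAlg)).coeff n z = _
    rw [SkewMonoidAlgebra.coeff_add, Finsupp.add_apply, BoundedContinuousFunction.add_apply, ha, hb]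
    simp only [ev_add]
    split_ifs <;> ring
  | tmul v w =>
    have h2 : ((√2 : ℝ) : ℂ)⁻¹ * ((√2 : ℝ) : ℂ)⁻¹ = 2⁻¹ := by
      rw [← mul_inv, ← Complex.ofReal_mul, Real.mul_self_sqrt zero_le_two]
      norm_num
    rw [tensorTwo_tmul, map_mul, tensorHom, TensorAlgebra.lift_ι_apply, TensorAlgebra.lift_ι_apply]
    change ((X.genMap v : X.BigAlg) * (X.genMap w : X.BigAlg)).coeff n z = _
    rw [coe_genMap, coe_genMap, smul_mul_smul_comm, h2, mul_add, add_mul, add_mul,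
      SkewMonoidAlgebra.single_mul_single, SkewMonoidAlgebra.single_mul_single,
      SkewMonoidAlgebra.single_mul_single, SkewMonoidAlgebra.single_mul_single, ← ofAdd_add,
      ← ofAdd_add, ← ofAdd_add, ← ofAdd_add]
    norm_num only
    have hs : ∀ (m : Multiplicative ℤ) (f : X.Fun),
        ((SkewMonoidAlgebra.single m f : X.BigAlg).coeff n) z = if n = m then f z else 0 := by
      intro m f
      rw [SkewMonoidAlgebra.coeff_single, Finsupp.single_apply]
      by_cases h : n = m
      · rw [if_pos h, if_pos h.symm]
      · rw [if_neg h, if_neg (Ne.symm h)]; rfl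
    simp only [SkewMonoidAlgebra.coeff_smul, SkewMonoidAlgebra.coeff_add, Finsupp.smul_apply,
      Finsupp.add_apply, BoundedContinuousFunction.smul_apply, BoundedContinuousFunction.add_apply,
      hs, BoundedContinuousFunction.mul_apply, smul_fun_apply, sectionFun_apply,
      conjSectionFun_apply, Frame.shift_vec, toAdd_ofAdd, ev_tmul, smul_eq_mul, ofAdd_zero]
    norm_num only
    split_ifs <;> ring

lemma eq_of_coeff_eq {a b : algCrossedProduct X}
    (h : ∀ n z, (a : X.BigAlg).coeff n z = (b : X.BigAlg).coeff n z) : a = b := by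
  apply Subtype.ext
  apply SkewMonoidAlgebra.ext
  intro n
  ext z
  exact h n z

/-- The relations are annihilated: in degrees `±2` because `(z k, z (k + 1))` lies over the
correspondence, in degree `0` because `Q` is central. -/
lemma tensorHom_rel (hσ : D.IsCorrespondence σ)
    (hcentral : D.IsCentralOn σ X.Q {p | p.1 ∈ X.KP ∧ p.2 = D.pconj p.1})
    {ω : V ⊗[ℂ] V} (hω : ω ∈ D.R) : X.tensorHom (tensorTwo V ω) = 0 := by
  refine eq_of_coeff_eq fun n z => ?_
  rw [coeff_tensorHom_tensorTwo]
  have h1 := z.ev_succ hσ hω 0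
  have h2 := z.ev_conj_succ hσ hω (-2)
  have h3 := z.ev_add_ev_eq_zero hσ hcentral hω (-1)
  norm_num only at h1 h2 h3
  rw [h1, h2, h3]
  simp

variable (X) in
/-- The `*`-homomorphism from `A(V,R)` to the `*`-algebra of finite sums induced by `tensorHom`. -/
def quadraticHom (hσ : D.IsCorrespondence σ)
    (hcentral : D.IsCentralOn σ X.Q {p | p.1 ∈ X.KP ∧ p.2 = D.pconj p.1}) :
    D.Alg →⋆ₐ[ℂ] algCrossedProduct X :=
  let φ : D.Alg →ₐ[ℂ] algCrossedProduct X := RingQuot.liftAlgHom ℂ ⟨X.tensorHom, by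
    rintro _ _ ⟨ω, hω, rfl, rfl⟩
    rw [map_zero, tensorHom_rel hσ hcentral hω]⟩
  have hφ : ∀ x, φ (D.quot x) = X.tensorHom x := fun x => RingQuot.liftAlgHom_mkAlgHom_apply _ _ _ x
  { φ with
    map_star' := fun a => by
      obtain ⟨x, rfl⟩ := RingQuot.mkAlgHom_surjective ℂ D.Rel a
      change φ (star (D.quot x)) = star (φ (D.quot x))
      rw [D.star_quot, hφ, hφ]
      induction x using TensorAlgebra.induction with
      | algebraMap c =>
        rw [D.tstar_algebraMap, AlgHom.commutes, AlgHom.commutes]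
        exact algebraMap_star_comm c
      | ι v => rw [D.tstar_ι, tensorHom, TensorAlgebra.lift_ι_apply, TensorAlgebra.lift_ι_apply,
          star_genMap]
      | mul a b ha hb => rw [D.tstar_mul, map_mul, map_mul, star_mul, ha, hb]
      | add a b ha hb => rw [D.tstar_add, map_add, map_add, star_add, ha, hb] }

lemma quadraticHom_quot (hσ : D.IsCorrespondence σ)
    (hcentral : D.IsCentralOn σ X.Q {p | p.1 ∈ X.KP ∧ p.2 = D.pconj p.1})
    (x : TensorAlgebra ℂ V) : X.quadraticHom hσ hcentral (D.quot x) = X.tensorHom x :=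
  RingQuot.liftAlgHom_mkAlgHom_apply _ _ _ x

lemma quadraticHom_gen (hσ : D.IsCorrespondence σ)
    (hcentral : D.IsCentralOn σ X.Q {p | p.1 ∈ X.KP ∧ p.2 = D.pconj p.1}) (Y : V) :
    X.quadraticHom hσ hcentral (D.gen Y) = X.genMap Y :=
  (quadraticHom_quot hσ hcentral _).trans (TensorAlgebra.lift_ι_apply _ _)

lemma norm_sqrt_two_smul {E : Type*} [SeminormedAddCommGroup E] [NormedSpace ℂ E] (x : E) :
    ‖((√2 : ℝ) : ℂ) • x‖ = √2 * ‖x‖ := by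
  rw [norm_smul, Complex.norm_real, Real.norm_of_nonneg (Real.sqrt_nonneg _)]

lemma sqrt_two_smul_toCrossedProduct (Y : V) :
    ((√2 : ℝ) : ℂ) • X.toCrossedProduct (X.genMap Y) =
      X.sectionW Y + star (X.sectionW (D.j Y)) := by
  rw [← map_smul, sqrt_two_smul_genMap, map_add, map_star]
  rfl

lemma iSup_sectionNorm_le (Y : V) :
    ⨆ Z : X.KP, X.sectionNorm Y Z ≤ √2 * ‖X.toCrossedProduct (X.genMap Y)‖ := by
  rw [← norm_sqrt_two_smul, ← map_smul]
  refine Real.iSup_le ?_ (norm_nonneg _)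
  rintro ⟨_, Z, hZ, rfl⟩
  obtain ⟨z, rfl⟩ := Frame.exists_pt_zero X Z hZ
  change X.sectionNorm Y (z.pt 0) ≤ _
  rw [sectionNorm_pt]
  refine le_trans (le_of_eq ?_) (norm_coeff_le _ (Multiplicative.ofAdd 1) z)
  -- the coefficient of `W` in `Y W + W* Ȳ*` is `Y`
  have h : ((((√2 : ℝ) : ℂ) • X.genMap Y : algCrossedProduct X) : X.BigAlg) =
      SkewMonoidAlgebra.single (Multiplicative.ofAdd 1) (X.sectionFun Y) +
        SkewMonoidAlgebra.single (Multiplicative.ofAdd (-1)) (X.conjSectionFun Y) := by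
    change ((√2 : ℝ) : ℂ) • (X.genMap Y : X.BigAlg) = _
    rw [coe_genMap, smul_inv_smul₀ (by norm_cast; positivity)]
  classical
  rw [h, SkewMonoidAlgebra.coeff_add, Finsupp.add_apply, SkewMonoidAlgebra.coeff_single,
    SkewMonoidAlgebra.coeff_single, Finsupp.single_apply, Finsupp.single_apply, if_pos rfl,
    if_neg (by decide), add_zero, sectionFun_apply]

lemma norm_toCrossedProduct_genMap_le (Y : V) :
    √2 * ‖X.toCrossedProduct (X.genMap Y)‖ ≤
      (⨆ Z : X.KP, X.sectionNorm Y Z) + ⨆ Z : X.KP, X.sectionNorm (D.j Y) Z := by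
  have h : ∀ Y, ‖X.sectionW Y‖ ≤ ⨆ Z : X.KP, X.sectionNorm Y Z := fun Y =>
    (norm_toCrossedProduct_monomial_le _ _ _).trans (norm_sectionFun_le Y)
  rw [← norm_sqrt_two_smul, sqrt_two_smul_toCrossedProduct]
  refine (norm_add_le _ _).trans (add_le_add (h Y) ?_)
  rw [norm_star]
  exact h _

/-- If `Q` vanishes on the correspondence over `K` and over its conjugate, then `Q` is mapped
to `1`: the components of degree `±2` vanish, and the component of degree `0` is
`(Q(z 0, z̄ 0) + Q(z̄ (-1), z (-1))) / 2 = 1`. -/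
lemma tensorHom_Q (h : ∀ (z : X.Frame) (k : ℤ), ev X.Q (z.vec k) (z.vec (k + 1)) = 0)
    (h' : ∀ (z : X.Frame) (k : ℤ), ev X.Q (D.conj (z.vec (k + 1))) (D.conj (z.vec k)) = 0) :
    X.tensorHom (tensorTwo V X.Q) = 1 := by
  classical
  refine eq_of_coeff_eq fun n z => ?_
  rw [coeff_tensorHom_tensorTwo]
  have h1 := h z 0
  have h2 := h' z (-2)
  norm_num only at h1 h2
  have h3 : ev X.Q (z.vec 0) (D.conj (z.vec 0)) = 1 := z.unit 0
  have h4 : ev X.Q (D.conj (z.vec (-1))) (z.vec (-1)) = 1 := by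
    rw [← ev_comm, X.symm]; exact z.unit _
  rw [h1, h2, h3, h4]
  change _ = (1 : X.BigAlg).coeff n z
  rw [SkewMonoidAlgebra.coeff_one, Finsupp.single_apply]
  by_cases hn : n = 1
  · subst hn
    simp only [ite_self, zero_add, add_zero, if_true]
    rw [show (1 : X.Fun) z = 1 from rfl]
    norm_num
  · rw [if_neg hn, if_neg (Ne.symm hn)]
    simp

end PositiveDatum

end QuadCross

namespace QuadCross

variable {V : Type u} [AddCommGroup V] [Module ℂ V]

/-! ### Homogeneous polynomial functions on the dual space -/

/-- The function `g` on `V*` is given by a homogeneous polynomial of degree `d` in the linear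
functions `φ ↦ φ v`. -/
def IsForm (d : ℕ) (g : Module.Dual ℂ V → ℂ) : Prop :=
  ∃ f : MvPolynomial V ℂ, f.IsHomogeneous d ∧ ∀ φ, MvPolynomial.eval (fun v => φ v) f = g φ

namespace IsForm

lemma apply (v : V) : IsForm 1 (fun φ : Module.Dual ℂ V => φ v) :=
  ⟨MvPolynomial.X v, MvPolynomial.isHomogeneous_X ℂ v, fun _ => MvPolynomial.eval_X v⟩

lemma const (c : ℂ) : IsForm 0 (fun _ : Module.Dual ℂ V => c) :=
  ⟨MvPolynomial.C c, MvPolynomial.isHomogeneous_C _ c, fun _ => MvPolynomial.eval_C c⟩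

lemma zero (d : ℕ) : IsForm d (fun _ : Module.Dual ℂ V => 0) :=
  ⟨0, MvPolynomial.isHomogeneous_zero _ _ d, fun _ => map_zero _⟩

lemma add {d : ℕ} {g h : Module.Dual ℂ V → ℂ} (hg : IsForm d g) (hh : IsForm d h) :
    IsForm d (fun φ => g φ + h φ) := by
  obtain ⟨f, hf, hfg⟩ := hg
  obtain ⟨f', hf', hfh⟩ := hh
  exact ⟨f + f', hf.add hf', fun φ => by rw [map_add, hfg, hfh]⟩

lemma mul {d e : ℕ} {g h : Module.Dual ℂ V → ℂ} (hg : IsForm d g) (hh : IsForm e h) :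
    IsForm (d + e) (fun φ => g φ * h φ) := by
  obtain ⟨f, hf, hfg⟩ := hg
  obtain ⟨f', hf', hfh⟩ := hh
  exact ⟨f * f', hf.mul hf', fun φ => by rw [map_mul, hfg, hfh]⟩

lemma const_mul {d : ℕ} (c : ℂ) {g : Module.Dual ℂ V → ℂ} (hg : IsForm d g) :
    IsForm d (fun φ => c * g φ) := by
  simpa using (const (V := V) c).mul hg

lemma sub {d : ℕ} {g h : Module.Dual ℂ V → ℂ} (hg : IsForm d g) (hh : IsForm d h) :
    IsForm d (fun φ => g φ - h φ) := by
  simpa [sub_eq_add_neg] using hg.add (hh.const_mul (-1))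

lemma sum {ι : Type*} {d : ℕ} (s : Finset ι) (g : ι → Module.Dual ℂ V → ℂ)
    (hg : ∀ i ∈ s, IsForm d (g i)) : IsForm d (fun φ => ∑ i ∈ s, g i φ) := by
  classical
  induction s using Finset.induction_on with
  | empty => simpa using zero (V := V) d
  | insert i s hi ih =>
    simp only [Finset.sum_insert hi]
    exact (hg i (by simp)).add (ih fun k hk => hg k (by simp [hk]))

lemma prod {ι : Type*} (s : Finset ι) (d : ι → ℕ) (g : ι → Module.Dual ℂ V → ℂ)
    (hg : ∀ i ∈ s, IsForm (d i) (g i)) : IsForm (∑ i ∈ s, d i) (fun φ => ∏ i ∈ s, g i φ) := by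
  classical
  induction s using Finset.induction_on with
  | empty => simpa using const (V := V) 1
  | insert i s hi ih =>
    simp only [Finset.prod_insert hi, Finset.sum_insert hi]
    exact (hg i (by simp)).mul (ih fun k hk => hg k (by simp [hk]))

lemma comp {d e : ℕ} {g : Module.Dual ℂ V → ℂ} (hg : IsForm d g)
    {P : Module.Dual ℂ V → Module.Dual ℂ V} (hP : ∀ v, IsForm e (fun φ => P φ v)) :
    IsForm (e * d) (fun φ => g (P φ)) := by
  obtain ⟨f, hf, hfg⟩ := hg
  choose p hp hpP using hP
  refine ⟨MvPolynomial.aeval p f, hf.aeval p hp, fun φ => ?_⟩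
  exact (MvPolynomial.eval₂Hom_bind₁ (RingHom.id ℂ) _ p f).trans
    ((congrArg (MvPolynomial.eval · f) (funext fun v => hpP v φ)).trans (hfg (P φ)))

lemma ev {d e : ℕ} {P P' : Module.Dual ℂ V → Module.Dual ℂ V}
    (hP : ∀ v, IsForm d (fun φ => P φ v)) (hP' : ∀ v, IsForm e (fun φ => P' φ v))
    (ω : V ⊗[ℂ] V) : IsForm (d + e) (fun φ => ev ω (P φ) (P' φ)) := by
  induction ω using TensorProduct.induction_on with
  | zero => simpa [QuadCross.ev] using zero (V := V) _
  | tmul v w => simpa only [ev_tmul] using (hP v).mul (hP' w)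
  | add x y hx hy => simpa only [ev_add] using hx.add hy

/-- The determinant of a matrix of forms whose rows have degrees `d i`. -/
lemma det {n : ℕ} (d : Fin n → ℕ) (M : Module.Dual ℂ V → Matrix (Fin n) (Fin n) ℂ)
    (hM : ∀ i k, IsForm (d i) (fun φ => M φ k i)) : IsForm (∑ i, d i) (fun φ => (M φ).det) := by
  simp only [Matrix.det_apply, Units.smul_def, zsmul_eq_mul]
  exact sum _ _ fun τ _ => (prod _ _ _ fun i _ => hM i _).const_mul _

lemma smul {d : ℕ} {g : Module.Dual ℂ V → ℂ} (hg : IsForm d g) (c : ℂ) (φ : Module.Dual ℂ V) :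
    g (c • φ) = c ^ d * g φ := by
  obtain ⟨f, hf, hfg⟩ := hg
  rw [← hfg, ← hfg, MvPolynomial.eval_eq, MvPolynomial.eval_eq, Finset.mul_sum]
  refine Finset.sum_congr rfl fun m hm => ?_
  have hd : ∑ i ∈ m.support, m i = d := by
    have h := hf (MvPolynomial.mem_support_iff.1 hm)
    simpa [Finsupp.weight_apply, Finsupp.sum] using h
  simp only [LinearMap.smul_apply, smul_eq_mul, mul_pow, Finset.prod_mul_distrib,
    Finset.prod_pow_eq_pow_sum, hd]
  ring

/-- If neither of two forms vanishes identically on a Zariski-irreducible set, then both are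
nonzero at some point of it. -/
lemma exists_ne_zero {d e : ℕ} {g h : Module.Dual ℂ V → ℂ} (hg : IsForm d g) (hh : IsForm e h)
    {S : Set (PDual V)} (hS : @IsIrreducible _ (zariskiTopology V) S)
    (hgS : ∃ Z ∈ S, g Z.rep ≠ 0) (hhS : ∃ Z ∈ S, h Z.rep ≠ 0) :
    ∃ Z ∈ S, g Z.rep ≠ 0 ∧ h Z.rep ≠ 0 := by
  let _ := zariskiTopology V
  have hopen : ∀ {d : ℕ} {g : Module.Dual ℂ V → ℂ}, IsForm d g →
      IsOpen {Z : PDual V | g Z.rep ≠ 0} := by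
    rintro d g ⟨f, hf, hfg⟩
    exact TopologicalSpace.isOpen_generateFrom_of_mem ⟨f, d, hf, by simp only [hfg]⟩
  exact hS.2 _ _ (hopen hg) (hopen hh) hgS hhS

end IsForm

/-! ### The correspondence is given locally by forms -/

/-- The contraction `ω(φ, ·)` of a tensor with a linear form. -/
def contract : V ⊗[ℂ] V →ₗ[ℂ] Module.Dual ℂ V →ₗ[ℂ] V :=
  TensorProduct.lift (LinearMap.mk₂ ℂ (fun v w => (Module.Dual.eval ℂ V v).smulRight w)
    (fun v v' w => by ext φ; simp [add_smul]) (fun c v w => by ext φ; simp [mul_smul])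
    (fun v w w' => by ext φ; simp) (fun c v w => by ext φ; simp [smul_comm c]))

lemma apply_contract (ω : V ⊗[ℂ] V) (α β : Module.Dual ℂ V) :
    β (contract ω α) = ev ω α β := by
  induction ω using TensorProduct.induction_on with
  | zero => simp [ev]
  | tmul v w => simp [contract, ev_tmul]
  | add x y hx hy => rw [map_add, LinearMap.add_apply, map_add, hx, hy, ev_add]

/-- The linear form `v ↦ det(v, ω₁(φ, ·), …, ω_m(φ, ·))`, which vanishes on
all `ωᵢ(φ, ·)`. -/
def cofactor {m : ℕ} (b : Module.Basis (Fin (m + 1)) ℂ V) (ω : Fin m → V ⊗[ℂ] V)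
    (φ : Module.Dual ℂ V) : Module.Dual ℂ V where
  toFun v := b.det (Fin.cons v fun i => contract (ω i) φ)
  map_add' v w := b.det.toMultilinearMap.cons_add _ v w
  map_smul' c v := b.det.toMultilinearMap.cons_smul _ c v

lemma cofactor_apply {m : ℕ} (b : Module.Basis (Fin (m + 1)) ℂ V) (ω : Fin m → V ⊗[ℂ] V)
    (φ : Module.Dual ℂ V) (v : V) :
    cofactor b ω φ v = b.det (Fin.cons v fun i => contract (ω i) φ) := rfl

lemma isForm_cofactor {m : ℕ} (b : Module.Basis (Fin (m + 1)) ℂ V) (ω : Fin m → V ⊗[ℂ] V)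
    (v : V) : IsForm m (fun φ => cofactor b ω φ v) := by
  simp only [cofactor_apply, Module.Basis.det_apply]
  have h := IsForm.det (V := V) (Fin.cons 0 fun _ : Fin m => 1)
    (fun φ => b.toMatrix (Fin.cons v fun i => contract (ω i) φ)) (by
      intro i k
      refine Fin.cases ?_ (fun i => ?_) i
      · simpa [Module.Basis.toMatrix_apply] using IsForm.const (V := V) (b.repr v k)
      · have h1 : ∀ φ, b.repr (contract (ω i) φ) k = ev (ω i) φ (b.coord k) := fun φ => by
          rw [← apply_contract]; rfl
        simp only [Module.Basis.toMatrix_apply, Fin.cons_succ, h1]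
        simpa using IsForm.ev (V := V) (P := fun φ => φ) (P' := fun _ => b.coord k)
          IsForm.apply (fun w => IsForm.const _) (ω i))
  simpa [Fin.sum_univ_succ] using h

/-- Cramer's rule: a nonzero linear form that vanishes on all `ωᵢ(φ, ·)` is proportional to a
nonzero cofactor. -/
lemma exists_smul_eq_cofactor {m : ℕ} (b : Module.Basis (Fin (m + 1)) ℂ V)
    (ω : Fin m → V ⊗[ℂ] V) {φ ψ : Module.Dual ℂ V} (hψ : ψ ≠ 0)
    (h : ∀ i, ev (ω i) φ ψ = 0) (hc : cofactor b ω φ ≠ 0) :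
    ∃ t : ℂ, cofactor b ω φ = t • ψ := by
  obtain ⟨v, hv⟩ : ∃ v, cofactor b ω φ v ≠ 0 := by
    by_contra! h0
    exact hc (LinearMap.ext h0)
  have hb := (b.is_basis_iff_det (v := Fin.cons v fun i => contract (ω i) φ)).2
    (isUnit_iff_ne_zero.2 hv)
  let b' := Module.Basis.mk hb.1 hb.2.ge
  have h0 : b' 0 = v := by simp [b']
  have hs : ∀ i : Fin m, b' i.succ = contract (ω i) φ := by intro i; simp [b']
  have hc0 : ∀ i : Fin m, cofactor b ω φ (contract (ω i) φ) = 0 := fun i =>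
    b.det.map_eq_zero_of_eq _ (i := 0) (j := i.succ) (by simp) (Fin.succ_ne_zero i).symm
  have hψv : ψ v ≠ 0 := by
    intro h1
    refine hψ (b'.ext fun i => ?_)
    refine Fin.cases ?_ (fun i => ?_) i
    · rw [h0, h1]; rfl
    · rw [hs, apply_contract, h]; rfl
  refine ⟨cofactor b ω φ v / ψ v, b'.ext fun i => ?_⟩
  refine Fin.cases ?_ (fun i => ?_) i
  · rw [h0, LinearMap.smul_apply, smul_eq_mul, div_mul_cancel₀ _ hψv]
  · rw [hs, hc0, LinearMap.smul_apply, apply_contract, h, smul_zero]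

namespace StarQuadratic

variable {D : StarQuadratic V} {σ : Equiv.Perm D.charVar}

/-- At every point of the characteristic variety some cofactor is nonzero, since the relations
leave only one line of solutions `σ(Z)`. -/
lemma IsCorrespondence.exists_cofactor_ne_zero (hσ : D.IsCorrespondence σ) {m : ℕ}
    (b : Module.Basis (Fin (m + 1)) ℂ V) (Z : D.charVar) :
    ∃ ω : Fin m → V ⊗[ℂ] V, (∀ i, ω i ∈ D.R) ∧ cofactor b ω Z.1.rep ≠ 0 := by
  have := Module.Finite.of_basis b
  let ψ := (σ Z).1.rep
  have hψ : ψ ≠ 0 := Projectivization.rep_nonzero _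
  let W : Subspace ℂ V := D.R.map (contract.flip Z.1.rep)
  have hann : W.dualAnnihilator = Submodule.span ℂ {ψ} := by
    refine le_antisymm (fun χ hχ => ?_) ?_
    · by_cases h0 : χ = 0
      · rw [h0]; exact Submodule.zero_mem _
      rw [Submodule.mem_dualAnnihilator] at hχ
      have h1 : (Z.1, Projectivization.mk ℂ χ h0) ∈ D.Γ := by
        rw [← Projectivization.mk_rep Z.1, mk_mem_Γ]
        intro ω hω
        rw [← apply_contract]
        exact hχ _ (Submodule.mem_map_of_mem hω)
      obtain ⟨hx, h2⟩ := (hσ _ _).1 h1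
      rw [← Projectivization.mk_rep (σ ⟨Z.1, hx⟩).1, Projectivization.mk_eq_mk_iff'] at h2
      obtain ⟨t, ht⟩ := h2
      by_cases ht0 : t = 0
      · exact absurd (ht.symm.trans (by rw [ht0, zero_smul])) hψ
      rw [Submodule.mem_span_singleton]
      refine ⟨t⁻¹, ?_⟩
      change t⁻¹ • (σ ⟨Z.1, hx⟩).1.rep = χ
      rw [← ht, inv_smul_smul₀ ht0]
    · rw [Submodule.span_singleton_le_iff_mem, Submodule.mem_dualAnnihilator]
      rintro _ ⟨ω, hω, rfl⟩
      rw [LinearMap.flip_apply, apply_contract]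
      exact hσ.mem_Γ Z ω hω
  have hrank : Module.finrank ℂ W = m := by
    have h1 := Subspace.finrank_add_finrank_dualAnnihilator_eq W
    rw [hann, finrank_span_singleton hψ, Module.finrank_eq_card_basis b, Fintype.card_fin] at h1
    omega
  let w := Module.finBasisOfFinrankEq ℂ W hrank
  choose ω hω hωw using fun i => (w i).2
  refine ⟨ω, hω, fun h0 => ?_⟩
  obtain ⟨v, hv⟩ : ∃ v, v ∉ W := by
    by_contra! h
    have : W = ⊤ := eq_top_iff.2 fun v _ => h v
    rw [this, finrank_top, Module.finrank_eq_card_basis b, Fintype.card_fin] at hrank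
    omega
  have hrange : Submodule.span ℂ (Set.range fun i => (w i : V)) = W := by
    have h1 := w.span_eq
    have h2 := congrArg (Submodule.map W.subtype) h1
    rw [Submodule.map_span, ← Set.range_comp, Submodule.map_subtype_top] at h2
    exact h2
  have hli : LinearIndependent ℂ (Fin.cons v fun i => (w i : V) : Fin (m + 1) → V) :=
    (w.linearIndependent.map' W.subtype W.ker_subtype).finCons (by
      change v ∉ Submodule.span ℂ (Set.range fun i => (w i : V))
      rwa [hrange])
  have hspan := hli.span_eq_top_of_card_eq_finrank (by
    rw [Module.finrank_eq_card_basis b])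
  have hdet := (b.is_basis_iff_det).1 ⟨hli, hspan⟩
  have h3 : cofactor b ω Z.1.rep v = 0 := by rw [h0]; rfl
  rw [cofactor_apply] at h3
  have h4 : (fun i => contract (ω i) Z.1.rep) = fun i => (w i : V) := funext hωw
  rw [h4] at h3
  rw [h3] at hdet
  exact not_isUnit_zero hdet

/-- The iterates of `σ` are given by forms in a neighbourhood of every point. -/
lemma IsCorrespondence.exists_forms [FiniteDimensional ℂ V] (hσ : D.IsCorrespondence σ) (k : ℕ)
    (Z : D.charVar) : ∃ (d : ℕ) (P : Module.Dual ℂ V → Module.Dual ℂ V),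
      (∀ v, IsForm d fun φ => P φ v) ∧ P Z.1.rep ≠ 0 ∧
      ∀ (Z' : D.charVar), P Z'.1.rep ≠ 0 → ∃ t : ℂ, P Z'.1.rep = t • ((σ ^ k) Z').1.rep := by
  induction k with
  | zero => exact ⟨1, id, IsForm.apply, Projectivization.rep_nonzero _,
      fun Z' _ => ⟨1, by simp⟩⟩
  | succ k ih =>
    obtain ⟨d, P, hP, hPZ, hPσ⟩ := ih
    obtain ⟨v, hv⟩ : ∃ v, P Z.1.rep v ≠ 0 := by
      by_contra! h0
      exact hPZ (LinearMap.ext h0)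
    have hpos : 0 < Module.finrank ℂ V := by
      refine Module.finrank_pos_iff_exists_ne_zero.2 ⟨v, fun h0 => hv (by rw [h0, map_zero])⟩
    obtain ⟨m, hm⟩ := Nat.exists_eq_succ_of_ne_zero hpos.ne'
    let b := Module.finBasisOfFinrankEq ℂ V hm
    obtain ⟨ω, hω, hωZ⟩ := hσ.exists_cofactor_ne_zero b ((σ ^ k) Z)
    have hcof : ∀ (φ : Module.Dual ℂ V) (t : ℂ) (w : V),
        cofactor b ω (t • φ) w = t ^ m * cofactor b ω φ w := fun φ t w =>
      (isForm_cofactor b ω w).smul t φ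
    have hsmul : ∀ (φ : Module.Dual ℂ V) (t : ℂ),
        cofactor b ω (t • φ) = t ^ m • cofactor b ω φ := fun φ t => LinearMap.ext (hcof φ t)
    -- the factor `P φ v` excludes the points at which `P` vanishes
    refine ⟨d + d * m, fun φ => P φ v • cofactor b ω (P φ), fun w => ?_, ?_, fun Z' hZ' => ?_⟩
    · exact (hP v).mul ((isForm_cofactor b ω w).comp hP)
    · obtain ⟨t, ht⟩ := hPσ Z hPZ
      have ht0 : t ≠ 0 := by
        rintro rfl
        exact hPZ (by rw [ht, zero_smul])
      refine smul_ne_zero hv ?_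
      rw [ht, hsmul]
      exact smul_ne_zero (pow_ne_zero _ ht0) hωZ
    · have hv' : P Z'.1.rep v ≠ 0 := fun h0 => hZ' (by
        change P Z'.1.rep v • _ = _
        rw [h0, zero_smul])
      have hP' : P Z'.1.rep ≠ 0 := fun h0 => hv' (by rw [h0]; rfl)
      have hc' : cofactor b ω (P Z'.1.rep) ≠ 0 := fun h0 => hZ' (by
        change _ • cofactor b ω (P Z'.1.rep) = 0
        rw [h0, smul_zero])
      obtain ⟨t, ht⟩ := hPσ Z' hP'
      obtain ⟨s, hs⟩ := exists_smul_eq_cofactor b ω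
        (Projectivization.rep_nonzero (σ ((σ ^ k) Z')).1) (φ := P Z'.1.rep) (fun i => by
          rw [ht, ← one_smul ℂ (σ ((σ ^ k) Z')).1.rep, ev_smul_smul,
            hσ.mem_Γ ((σ ^ k) Z') (ω i) (hω i), mul_zero]) hc'
      refine ⟨P Z'.1.rep v * s, ?_⟩
      change P Z'.1.rep v • cofactor b ω (P Z'.1.rep) = _
      rw [hs, smul_smul, pow_succ', Equiv.Perm.mul_apply]

/-- If `Q` is central on `S × S` for an irreducible `σ`-stable `S ⊆ E` on which `σ⁴ ≠ 1`, then
`Q` vanishes on the graph of `σ` over `S`. -/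
lemma IsCorrespondence.ev_eq_zero_of_isCentralOn [FiniteDimensional ℂ V]
    (hσ : D.IsCorrespondence σ) {Q : V ⊗[ℂ] V} {S : Set (PDual V)} (hSE : S ⊆ D.charVar)
    (hS : @IsIrreducible _ (zariskiTopology V) S)
    (hSσ : ∀ Z : D.charVar, (Z : PDual V) ∈ S → (σ Z : PDual V) ∈ S)
    (hcentral : D.IsCentralOn σ Q (S ×ˢ S))
    (h4 : ∃ Z : D.charVar, (Z : PDual V) ∈ S ∧ (σ ^ 4) Z ≠ Z)
    (Z : D.charVar) (hZ : (Z : PDual V) ∈ S) : ev Q Z.1.rep (σ Z).1.rep = 0 := by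
  -- centrality at `(Z, σ(Z))`
  have key : ∀ Z : D.charVar, (Z : PDual V) ∈ S → ev Q Z.1.rep (σ Z).1.rep ≠ 0 →
      (σ ^ 4) Z = Z := by
    intro Z hZ hne
    have h1 : ((σ (σ Z) : PDual V), (σ.symm Z : PDual V)) ∈ D.Γ := by
      intro ω hω
      have h2 := hcentral Z (σ Z) ⟨hZ, hSσ Z hZ⟩ ω hω
      rw [hσ.mem_Γ Z ω hω, zero_mul, zero_add] at h2
      exact (mul_eq_zero.1 h2).resolve_left hne
    have h3 := hσ.eq_of_mem_Γ h1
    change σ (σ (σ (σ Z))) = Z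
    rw [h3, σ.apply_symm_apply]
  by_contra hne
  obtain ⟨Z₁, hZ₁, hσZ₁⟩ := h4
  obtain ⟨d, P, hP, hPZ, hPσ⟩ := hσ.exists_forms 1 Z
  obtain ⟨e, P', hP', hPZ', hPσ'⟩ := hσ.exists_forms 4 Z₁
  obtain ⟨t, ht⟩ := hPσ Z hPZ
  obtain ⟨t', ht'⟩ := hPσ' Z₁ hPZ'
  have ht0 : t ≠ 0 := by
    rintro rfl
    exact hPZ (by rw [ht, zero_smul])
  have ht0' : t' ≠ 0 := by
    rintro rfl
    exact hPZ' (by rw [ht', zero_smul])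
  -- some minor of `(P'(Z₁), Z₁)` is nonzero, as these vectors span different lines
  obtain ⟨v, w, hvw⟩ : ∃ v w : V, P' Z₁.1.rep v * Z₁.1.rep w - P' Z₁.1.rep w * Z₁.1.rep v ≠ 0 := by
    by_contra! h
    refine hσZ₁ (Subtype.ext ?_)
    obtain ⟨w, hw⟩ : ∃ w, Z₁.1.rep w ≠ 0 := by
      by_contra! h0
      exact Projectivization.rep_nonzero Z₁.1 (LinearMap.ext h0)
    rw [← Projectivization.mk_rep Z₁.1, ← Projectivization.mk_rep ((σ ^ 4) Z₁).1,
      Projectivization.mk_eq_mk_iff']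
    refine ⟨t'⁻¹ * (P' Z₁.1.rep w / Z₁.1.rep w), LinearMap.ext fun v => ?_⟩
    have h1 := h v w
    have h2 : P' Z₁.1.rep v = t' * ((σ ^ 4) Z₁).1.rep v := by rw [ht']; rfl
    rw [h2] at h1
    rw [LinearMap.smul_apply, smul_eq_mul]
    field_simp
    linear_combination -h1
  obtain ⟨Z₂, hZ₂, hQ, hne2⟩ := ((IsForm.ev IsForm.apply hP Q).exists_ne_zero
    (((hP' v).mul (IsForm.apply w)).sub ((hP' w).mul (IsForm.apply v))) hS
    ⟨Z.1, hZ, by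
      rw [ht, ← one_smul ℂ Z.1.rep, ev_smul_smul, one_mul, pow_one]
      exact mul_ne_zero ht0 hne⟩ ⟨Z₁.1, hZ₁, hvw⟩)
  let Y : D.charVar := ⟨Z₂, hSE hZ₂⟩
  have hPY : P Y.1.rep ≠ 0 := fun h0 => hQ (by
    change ev Q Z₂.rep (P Y.1.rep) = 0
    rw [h0, ← zero_smul ℂ (0 : Module.Dual ℂ V), ← one_smul ℂ Z₂.rep, ev_smul_smul]
    simp)
  obtain ⟨s, hs⟩ := hPσ Y hPY
  have hfix : (σ ^ 4) Y = Y := key Y hZ₂ fun h0 => hQ (by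
    change ev Q Y.1.rep (P Y.1.rep) = 0
    rw [hs, ← one_smul ℂ Y.1.rep, ev_smul_smul, pow_one, h0, mul_zero])
  by_cases hPY' : P' Y.1.rep = 0
  · exact hne2 (by
      change P' Y.1.rep v * Y.1.rep w - P' Y.1.rep w * Y.1.rep v = 0
      rw [hPY']; simp)
  · obtain ⟨s', hs'⟩ := hPσ' Y hPY'
    exact hne2 (by
      change P' Y.1.rep v * Y.1.rep w - P' Y.1.rep w * Y.1.rep v = 0
      rw [hs', hfix]
      simp only [LinearMap.smul_apply, smul_eq_mul]
      ring)

end StarQuadratic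

end QuadCross

end

theorem theorem6p2 {V : Type u} [AddCommGroup V] [Module ℂ V] [FiniteDimensional ℂ V]
    (D : QuadCross.StarQuadratic V) (σ : Equiv.Perm D.charVar) (hσ : D.IsCorrespondence σ)
    (X : QuadCross.PositiveDatum D σ)
    (hcentral : D.IsCentralOn σ X.Q {p | p.1 ∈ X.KP ∧ p.2 = D.pconj p.1}) :
    ∃ θ : D.Alg →⋆ₐ[ℂ] X.CrossedProduct,
      (∀ Y : V, ((√2 : ℝ) : ℂ) • θ (D.gen Y) = X.sectionW Y + star (X.sectionW (D.j Y))) ∧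
      (∀ Y : V,
        BddAbove (Set.range fun Z : X.KP => X.sectionNorm Y Z) ∧
        (⨆ Z : X.KP, X.sectionNorm Y Z) ≤ √2 * ‖θ (D.gen Y)‖ ∧
        √2 * ‖θ (D.gen Y)‖ ≤
          (⨆ Z : X.KP, X.sectionNorm Y Z) + (⨆ Z : X.KP, X.sectionNorm (D.j Y) Z) ∧
        ((D.j Y = Y ∨ D.pconj '' X.KP = X.KP) →
          √2 * ‖θ (D.gen Y)‖ ≤ 2 * ⨆ Z : X.KP, X.sectionNorm Y Z)) ∧
      (∀ S : Set (QuadCross.PDual V), QuadCross.IsComponent D.charVar S →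
        (∀ Z : D.charVar, (σ Z : QuadCross.PDual V) ∈ S ↔ (Z : QuadCross.PDual V) ∈ S) →
        D.pconj '' S = S → X.KP ⊆ S →
        D.IsCentralOn σ X.Q (S ×ˢ S) →
        (∃ Z : D.charVar, (Z : QuadCross.PDual V) ∈ S ∧ (σ ^ 4) Z ≠ Z) →
        θ (D.quad X.Q) = 1) := by
  refine ⟨X.toCrossedProduct.comp (X.quadraticHom hσ hcentral), fun Y => ?_, fun Y => ?_,
    fun S hS hSσ hSconj hKS hQ h4 => ?_⟩
  · rw [StarAlgHom.comp_apply, QuadCross.PositiveDatum.quadraticHom_gen]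
    exact QuadCross.PositiveDatum.sqrt_two_smul_toCrossedProduct Y
  · rw [StarAlgHom.comp_apply, QuadCross.PositiveDatum.quadraticHom_gen]
    refine ⟨QuadCross.PositiveDatum.bddAbove_sectionNorm Y,
      QuadCross.PositiveDatum.iSup_sectionNorm_le Y,
      QuadCross.PositiveDatum.norm_toCrossedProduct_genMap_le Y, fun h => ?_⟩
    refine (QuadCross.PositiveDatum.norm_toCrossedProduct_genMap_le Y).trans (le_of_eq ?_)
    rw [QuadCross.PositiveDatum.iSup_sectionNorm_j Y h, two_mul]
  · have hQS := hσ.ev_eq_zero_of_isCentralOn hS.prop.1 hS.prop.2 (fun Z => (hSσ Z).2) hQ h4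
    have hptS : ∀ (z : X.Frame) (k : ℤ), (z.pt k : QuadCross.PDual V) ∈ S := fun z k =>
      hKS ⟨_, z.pt_mem k, rfl⟩
    rw [StarAlgHom.comp_apply, QuadCross.StarQuadratic.quad,
      QuadCross.PositiveDatum.quadraticHom_quot, QuadCross.PositiveDatum.tensorHom_Q, map_one]
    · intro z k
      rw [← QuadCross.ev_rep_eq_zero_iff _ (z.vec_ne k) (z.vec_ne (k + 1)), z.mk_vec, z.mk_vec,
        z.pt_succ]
      exact hQS _ (hptS z k)
    · intro z k
      rw [← QuadCross.ev_rep_eq_zero_iff _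
        (QuadCross.StarQuadratic.conj_ne_zero (z.vec_ne (k + 1)))
        (QuadCross.StarQuadratic.conj_ne_zero (z.vec_ne k)),
        ← QuadCross.StarQuadratic.pconj_mk (z.vec_ne _),
        ← QuadCross.StarQuadratic.pconj_mk (z.vec_ne _), z.mk_vec, z.mk_vec]
      -- `σ` maps the conjugate of `σ(Z)` to the conjugate of `Z`, so this is the vanishing of `Q`
      -- on the graph of `σ` over the conjugate of `σ(Z)`
      have h1 := congrArg Subtype.val (hσ.apply_pconj (z.pt k))
      simp only [← z.pt_succ] at h1
      have h2 := hQS ⟨_, hσ.pconj_mem (z.pt (k + 1))⟩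
        (hSconj ▸ Set.mem_image_of_mem _ (hptS z (k + 1)))
      rwa [h1] at h2
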